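/- All digraphs are finite, have at least one vertex, and have no loops or parallel arcs. A digraph is strong if for any two distinct vertices $u,v$ it contains a directed $u$–$v$ path and a directed $v$–$u$ path. The Cartesian product $D\square H$ has vertex set $V(D)\times V(H)$ and an arc from $(u,v)$ to $(u',v')$ exactly when $uu'\in A(D)$ and $v=v'$, or $u=u'$ and $vv'\in A(H)$. An out-tree rooted at $r$ is an orientation of a tree in which all vertices except $r$ have in-degree one. For $r\in S\subseteq V(D)$ with $|S|\ge 2$, a pendant $(S,r)$-tree in $D$ is a subdigraph of $D$ that is an out-tree rooted at $r$, contains all vertices of $S$, and in which every vertex of $S$ has degree (in-degree plus out-degree) one. Two pendant $(S,r)$-trees are internally-disjoint if they have no common arc and their common vertices are exactly those of $S$. Let $\tau_{S,r}(D)$ be the maximum number of pairwise internally-disjoint pendant $(S,r)$-trees in $D$, and let $$\tau_3(D)=\min\{\tau_{S,r}(D)\mid S\subseteq V(D),\ |S|=3,\ r\in S\},$$ with the convention $\tau_3(D)=0$ if $D$ has fewer than three vertices. **Theorem 1.1.** For any two strong digraphs $D$ and $H$, $$\tau_3(D\square H)\ge \tau_3(D)+\tau_3(H).$$ Moreover,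 this bound is sharp: for all integers $n,m\ge 3$, let $\overleftrightarrow{P_n}$ be the digraph on $u_1,\dots,u_n$ with arcs $u_iu_j$ for $|i-j|=1$, and let $\overrightarrow{C_m}$ be the directed cycle on $m$ vertices. Both are strong, and $$\tau_3(\overleftrightarrow{P_n}\square\overrightarrow{C_m})=0=\tau_3(\overleftrightarrow{P_n})+\tau_3(\overrightarrow{C_m}).$$ -/

import Mathlib

namespace Digraph

/-- No vertex carries a loop. (Parallel arcs are impossible in `Digraph`, whose arcs are a relation.) -/
def Loopless {V : Type*} (D : Digraph V) : Prop :=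
  ∀ v, ¬ D.Adj v v

/-- `D` is strong: between any two distinct vertices there are directed connections both ways
(as the pair `u`, `v` is ordered, one direction per pair suffices).
`Relation.ReflTransGen D.Adj u v` says that there is a directed walk, equivalently a directed path,
from `u` to `v`. -/
def IsStrong {V : Type*} (D : Digraph V) : Prop :=
  ∀ u v, u ≠ v → Relation.ReflTransGen D.Adj u v

/-- The Cartesian product of digraphs. -/
def boxProd {V W : Type*} (D : Digraph V) (H : Digraph W) : Digraph (V × W) where
  Adj p q := (D.Adj p.1 q.1 ∧ p.2 = q.2) ∨ (p.1 = q.1 ∧ H.Adj p.2 q.2)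

/-- A subdigraph of `D`: a set of vertices, and a set of arcs of `D` with both ends among them. -/
structure Subdigraph {V : Type*} (D : Digraph V) where
  verts : Set V
  Arc : V → V → Prop
  adj_of_arc : ∀ {u v}, Arc u v → D.Adj u v
  left_mem : ∀ {u v}, Arc u v → u ∈ verts
  right_mem : ∀ {u v}, Arc u v → v ∈ verts

namespace Subdigraph

variable {V : Type*} {D : Digraph V}

/-- The in-degree of `v` in `T`. -/
noncomputable def inDeg (T : D.Subdigraph) (v : V) : ℕ :=
  {u | u ≠ v ∧ T.Arc u v}.ncard

/-- The out-degree of `v` in `T`. -/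
noncomputable def outDeg (T : D.Subdigraph) (v : V) : ℕ :=
  {u | u ≠ v ∧ T.Arc v u}.ncard

/-- The degree of `v` in `T`. -/
noncomputable def deg (T : D.Subdigraph) (v : V) : ℕ :=
  T.outDeg v + T.inDeg v

/-- The underlying undirected simple graph of `T`, on the vertices of `T`. -/
def underlying (T : D.Subdigraph) : SimpleGraph T.verts :=
  SimpleGraph.fromRel fun u v => T.Arc u v

/-- `T` is an oriented tree: an orientation of an undirected tree
(no loops, no pair of opposite arcs, and the underlying graph is a tree). -/
def IsOrientedTree (T : D.Subdigraph) : Prop :=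
  (∀ u v, T.Arc u v → ¬ T.Arc v u) ∧ T.underlying.IsTree

/-- `T` is an out-tree rooted at `r`: an oriented tree in which all vertices except `r` have
in-degree one. -/
def IsOutTree (T : D.Subdigraph) (r : V) : Prop :=
  T.IsOrientedTree ∧ r ∈ T.verts ∧ ∀ v ∈ T.verts, T.inDeg v = 1 ↔ v ≠ r

/-- `T` is a pendant `(S, r)`-tree: an out-tree rooted at `r ∈ S` that contains all vertices of `S`
and in which every vertex of `S` has degree one. -/
def IsPendantTree (T : D.Subdigraph) (S : Finset V) (r : V) : Prop :=
  r ∈ S ∧ T.IsOutTree r ∧ (S : Set V) ⊆ T.verts ∧ ∀ v ∈ S, T.deg v = 1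

/-- `T₁` and `T₂` share no arcs, and their common vertices are exactly those of `S`. -/
def InternallyDisjoint (S : Finset V) (T₁ T₂ : D.Subdigraph) : Prop :=
  (∀ u v, ¬ (T₁.Arc u v ∧ T₂.Arc u v)) ∧ T₁.verts ∩ T₂.verts = (S : Set V)

end Subdigraph

/-- `τ_{S,r}(D)`: the maximum number of pairwise internally-disjoint pendant `(S, r)`-trees in `D`.
A pendant tree has at least one arc, so the members of such a family are distinct, and for a finite
digraph the set below is bounded. -/
noncomputable def localPendantTreeConnectivity {V : Type*} (D : Digraph V) (S : Finset V) (r : V) :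
    ℕ :=
  sSup {n | ∃ T : Fin n → D.Subdigraph, (∀ i, (T i).IsPendantTree S r) ∧
    Pairwise fun i j => Subdigraph.InternallyDisjoint S (T i) (T j)}

/-- `τ_k(D)`: the minimum of `τ_{S,r}(D)` over all `S ⊆ V(D)` with `|S| = k` and all `r ∈ S`.
It is `0` if `D` has fewer than `k` vertices, so that there is no such `S`. -/
noncomputable def pendantTreeConnectivity {V : Type*} (k : ℕ) (D : Digraph V) : ℕ :=
  sInf {t | ∃ S : Finset V, S.card = k ∧ ∃ r ∈ S, t = D.localPendantTreeConnectivity S r}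

/-- The symmetric digraph of the undirected path on `n` vertices. -/
def symmPath (n : ℕ) : Digraph (Fin n) where
  Adj i j := (i : ℕ) + 1 = j ∨ (j : ℕ) + 1 = i

/-- The directed cycle on `m` vertices. -/
def dirCycle (m : ℕ) : Digraph (Fin m) where
  Adj i j := ((i : ℕ) + 1) % m = j

end Digraph

/-!
Pendant trees on three terminals are replaced by connectors. A pendant tree from `x` to `y` and `z`
exists inside a set of vertices exactly if the set, with the terminals left out, contains an
out-neighbour of `x` from which in-neighbours of `y` and of `z` are reached inside the set: such a
set is a connector, and a breadth-first out-tree in it extends to a pendant tree. Internally-disjoint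
pendant trees become disjoint connectors (`le_localPendantTreeConnectivity_iff`), so arcs, degrees
and trees disappear from the problem.

Let `l = τ₃(H)` and let `x`, `y`, `z` be distinct vertices of the product. The `i`-th connector coming
from `H` starts in the fibre over `x.1`, reaches a vertex `s i` of `H` there, changes the first
coordinate freely at the second coordinate `s i`, and then goes from `s i` to `y.2` in the fibre over
`y.1` and to `z.2` in the fibre over `z.1`. If `x.2`, `y.2`, `z.2` are distinct, one family of
disjoint connectors of `H` serves all three fibres. If some of them coincide there is no such family,
but then different fibres may use different walks, and it suffices to combine connectors for other
triples of vertices with fans between a vertex and the `s i` (`exists_routing`). The fans come from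
Menger's theorem (`exists_disjoint_walks`), because `H` remains strong after the deletion of any `l`
vertices: with `b` among the deleted vertices, one of the `l` connectors from `u` to `v` and `b`
avoids all of them (`strongAfterDeleting_of_connectors`).

The connectors coming from `D` are built in the same way with the coordinates exchanged, except that
they change their second coordinate inside `H` minus all the vertices `s i`, which is still strong.
Then no connector from `D` meets one from `H`: apart from the transfers, each of them lies over
terminals, and its remaining coordinate avoids the coordinates of all terminals
(`Routing.notMem_spread`).

Equality holds for the path and the cycle because some vertex of each digraph considered has at most
two out-neighbours; if these are among the other two terminals, there is no connector.
-/

namespace Digraph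

/-! ### Walks inside a set of vertices -/

section Reach

variable {α : Type*}

/-- `ReachIn r U u v`: there is an `r`-walk from `u` to `v` all of whose vertices, `u` and `v`
included, lie in `U`. -/
def ReachIn (r : α → α → Prop) (U : Set α) (u v : α) : Prop :=
  u ∈ U ∧ Relation.ReflTransGen (fun a b => r a b ∧ b ∈ U) u v

/-- `HitsIn r U u v`: there is an `r`-walk from `u` to an in-neighbour of `v` inside `U`; the vertex
`v` itself need not lie in `U`. -/
def HitsIn (r : α → α → Prop) (U : Set α) (u v : α) : Prop :=
  ∃ w, ReachIn r U u w ∧ r w v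

variable {r r' : α → α → Prop} {U U' : Set α} {u v w : α}

theorem ReachIn.refl (h : u ∈ U) : ReachIn r U u u := ⟨h, .refl⟩

theorem ReachIn.left_mem (h : ReachIn r U u v) : u ∈ U := h.1

theorem ReachIn.right_mem (h : ReachIn r U u v) : v ∈ U := by
  rcases Relation.ReflTransGen.cases_tail h.2 with rfl | ⟨c, -, hc⟩
  exacts [h.1, hc.2]

theorem ReachIn.trans (h : ReachIn r U u v) (h' : ReachIn r U v w) : ReachIn r U u w :=
  ⟨h.1, h.2.trans h'.2⟩

theorem ReachIn.tail (h : ReachIn r U u v) (h' : r v w) (hw : w ∈ U) : ReachIn r U u w :=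
  ⟨h.1, h.2.tail ⟨h', hw⟩⟩

theorem ReachIn.mono (h : ReachIn r U u v) (hU : U ⊆ U') : ReachIn r U' u v :=
  ⟨hU h.1, Relation.ReflTransGen.mono (fun _ _ hab => ⟨hab.1, hU hab.2⟩) _ _ h.2⟩

theorem ReachIn.mono_rel (h : ReachIn r U u v) (hr : ∀ a b, r a b → r' a b) :
    ReachIn r' U u v :=
  ⟨h.1, Relation.ReflTransGen.mono (fun _ _ hab => ⟨hr _ _ hab.1, hab.2⟩) _ _ h.2⟩

/-- Induction along a walk inside `U`, extending it at its end. -/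
theorem ReachIn.rec_tail {p : α → Prop} (h : ReachIn r U u v) (h0 : p u)
    (hs : ∀ a b, ReachIn r U u a → p a → r a b → b ∈ U → p b) : p v := by
  obtain ⟨hu, h⟩ := h
  induction h with
  | refl => exact h0
  | tail hab hbc ih => exact hs _ _ ⟨hu, hab⟩ ih hbc.1 hbc.2

theorem ReachIn.swap (h : ReachIn r U u v) : ReachIn (Function.swap r) U v u := by
  refine h.rec_tail (p := fun x => ReachIn (Function.swap r) U x u) (.refl h.1) ?_
  intro a b _ hab hr hb
  exact (ReachIn.tail (.refl hb) (w := a) hr hab.left_mem).trans hab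

theorem ReachIn.reached (h : ReachIn r U u v) : ReachIn r {x | ReachIn r U u x} u v :=
  h.rec_tail (p := fun x => ReachIn r {x | ReachIn r U u x} u x) (.refl (.refl h.1))
    fun _ _ ha ih hr hb => ih.tail hr (ha.tail hr hb)

theorem ReachIn.map {β : Type*} {ρ : β → β → Prop} {f : α → β} {T : Set β}
    (h : ReachIn r U u v) (hf : ∀ a b, r a b → ρ (f a) (f b)) (hU : ∀ a ∈ U, f a ∈ T) :
    ReachIn ρ T (f u) (f v) :=
  h.rec_tail (p := fun x => ReachIn ρ T (f u) (f x)) (.refl (hU _ h.1))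
    fun _ _ _ ih hr hb => ih.tail (hf _ _ hr) (hU _ hb)

/-- A walk from `u` to `v ≠ u` can be stopped just before its first visit to `v`. -/
theorem ReachIn.hitsIn_diff (h : ReachIn r U u v) (huv : u ≠ v) : HitsIn r (U \ {v}) u v := by
  by_contra hn
  -- Otherwise every vertex of the walk, its end `v` included, is reached without meeting `v`.
  refine (h.rec_tail (p := ReachIn r (U \ {v}) u) (.refl ⟨h.1, huv⟩) ?_).right_mem.2 rfl
  rintro a b - ha hab hb
  refine ha.tail hab ⟨hb, ?_⟩
  rintro rfl
  exact hn ⟨a, ha, hab⟩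

theorem HitsIn.reachIn (h : HitsIn r U u v) (hU : U ⊆ U') (hv : v ∈ U') : ReachIn r U' u v :=
  let ⟨_, h1, h2⟩ := h
  (h1.mono hU).tail h2 hv

end Reach

/-! ### Menger's theorem -/

section Menger

variable {α : Type*}

/-- The step of Menger's theorem in which an arc leaving `x` is deleted: let `r'` contain all arcs of
`r` that do not leave `x`, and let `S` separate `A` from `B` in `r'`. A set `X` that does not separate
`A` from `B` in `r` does not separate `A` from `S ∪ {x}` in `r'` either, because a walk from `A` to `B`
has to meet `S ∪ {x}`, and up to its first vertex there it runs in `r'`. -/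
theorem exists_reachIn_insert {r r' : α → α → Prop} {A B S X : Set α} {x : α}
    (hrr : ∀ a b, r a b → a ≠ x → r' a b)
    (hS : ∀ a ∈ A, ∀ b ∈ B, ¬ ReachIn r' Sᶜ a b)
    (hX : ∃ a ∈ A, ∃ b ∈ B, ReachIn r Xᶜ a b) :
    ∃ a ∈ A, ∃ b ∈ insert x S, ReachIn r' Xᶜ a b := by
  by_contra! hn
  obtain ⟨a, ha, b, hb, hab⟩ := hX
  have key : ReachIn r' (Xᶜ ∩ (insert x S)ᶜ) a b := by
    refine hab.rec_tail (p := fun v => ReachIn r' (Xᶜ ∩ (insert x S)ᶜ) a v)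
      (.refl ⟨hab.1, fun h => hn a ha a h (.refl hab.1)⟩) ?_
    intro v w _ hv hvw hw
    have hvx : v ≠ x := by
      rintro rfl
      exact hv.right_mem.2 (Set.mem_insert _ _)
    have h1 := hrr _ _ hvw hvx
    exact hv.tail h1 ⟨hw, fun h => hn a ha w h
      ((hv.mono Set.inter_subset_left).tail h1 hw)⟩
  refine hS a ha b hb (key.mono ?_)
  rintro v ⟨-, hv⟩ hvS
  exact hv (Set.mem_insert_of_mem _ hvS)

/-- Disjoint walks from `A` onto all of `insert x S` can be trimmed to end at their first vertex in
`insert x S`; then they meet `S` only in their ends, and before that they avoid `S`. -/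
theorem exists_trimmed_walks [Finite α] {r : α → α → Prop} {A S : Set α} {x : α} {k : ℕ}
    (hk : (insert x S).ncard = k) {P : Fin k → Set α}
    (hP : Pairwise fun i j => Disjoint (P i) (P j))
    (hr : ∀ i, ∃ a ∈ A, ∃ b ∈ insert x S, ReachIn r (P i) a b) :
    ∃ U : α → Set α, (∀ p ∈ insert x S, ∃ a ∈ A, ReachIn r (U p) a p) ∧
      (∀ p ∈ insert x S, ∀ q ∈ insert x S, p ≠ q → Disjoint (U p) (U q)) ∧
      ∀ p ∈ insert x S, ∀ v ∈ U p, (v ∈ S → v = p) ∧ (v ∉ S → ∃ a ∈ A, ReachIn r Sᶜ a v) := by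
  choose a ha e he hae using hr
  have heinj : Function.Injective e := by
    intro i j hij
    by_contra hne
    exact Set.disjoint_left.1 (hP hne) (hae i).right_mem (hij ▸ (hae j).right_mem)
  have hrange : Set.range e = insert x S := by
    refine Set.eq_of_subset_of_ncard_le (Set.range_subset_iff.2 he) ?_ (Set.toFinite _)
    rw [hk, ← Set.image_univ, Set.ncard_image_of_injective _ heinj, Set.ncard_univ]
    simp
  have hmeet : ∀ i, ∀ v ∈ P i, v ∈ insert x S → v = e i := by
    intro i v hv hvS
    rw [← hrange] at hvS
    obtain ⟨j, rfl⟩ := hvS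
    by_contra hne
    have hij : i ≠ j := fun h => hne (by rw [h])
    exact Set.disjoint_left.1 (hP hij) hv (hae j).right_mem
  let W : Fin k → Set α := fun i => insert (e i) {v | ReachIn r (P i \ {e i}) (a i) v}
  have hWP : ∀ i, W i ⊆ P i := by
    rintro i v (rfl | hv)
    exacts [(hae i).right_mem, hv.right_mem.1]
  have hW : ∀ i, ReachIn r (W i) (a i) (e i) := by
    intro i
    by_cases h : a i = e i
    · rw [h]
      exact .refl (Set.mem_insert _ _)
    · obtain ⟨w, h1, h2⟩ := (hae i).hitsIn_diff h
      exact (h1.reached.mono (Set.subset_insert _ _)).tail h2 (Set.mem_insert _ _)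
  have hinv : ∀ p ∈ insert x S, ∃ i, e i = p := fun p hp => by rwa [← hrange] at hp
  refine ⟨fun p => {v | ∃ i, e i = p ∧ v ∈ W i}, ?_, ?_, ?_⟩
  · intro p hp
    obtain ⟨i, rfl⟩ := hinv p hp
    exact ⟨a i, ha i, (hW i).mono fun v hv => ⟨i, rfl, hv⟩⟩
  · intro p _ q _ hpq
    rw [Set.disjoint_left]
    rintro v ⟨i, rfl, hi⟩ ⟨j, rfl, hj⟩
    have hij : i ≠ j := fun h => hpq (by rw [h])
    exact Set.disjoint_left.1 (hP hij) (hWP i hi) (hWP j hj)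
  · rintro p - v ⟨i, rfl, hi⟩
    refine ⟨fun hv => hmeet i v (hWP i hi) (Set.mem_insert_of_mem _ hv), fun hv => ?_⟩
    refine ⟨a i, ha i, ?_⟩
    rcases hi with rfl | hi
    · refine (hae i).mono fun w hw hwS => hv ?_
      rwa [← hmeet i w hw (Set.mem_insert_of_mem _ hwS)]
    · exact hi.mono fun w hw hwS => hw.2 (hmeet i w hw.1 (Set.mem_insert_of_mem _ hwS))

/-- **Menger's theorem** for a relation on a finite type: if no set of fewer than `k` elements
separates `A` from `B`, then there are `k` disjoint walks from `A` to `B`. The walks are recorded by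
disjoint sets containing them. The proof is Göring's, by induction on the number of arcs. -/
theorem exists_disjoint_walks [Finite α] (k : ℕ) (r : α → α → Prop) (A B : Set α)
    (h : ∀ X : Set α, X.ncard < k → ∃ a ∈ A, ∃ b ∈ B, ReachIn r Xᶜ a b) :
    ∃ P : Fin k → Set α, (Pairwise fun i j => Disjoint (P i) (P j)) ∧
      ∀ i, ∃ a ∈ A, ∃ b ∈ B, ReachIn r (P i) a b := by
  induction hN : {p : α × α | r p.1 p.2}.ncard using Nat.strong_induction_on
    generalizing r A B with
  | _ N ih =>
  subst hN
  by_cases hemp : ∃ x y, r x y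
  · obtain ⟨x, y, hxy⟩ := hemp
    let r' : α → α → Prop := fun a b => r a b ∧ ¬ (a = x ∧ b = y)
    have hr'r : ∀ a b, r' a b → r a b := fun a b h => h.1
    have hrx : ∀ a b, r a b → a ≠ x → r' a b := fun a b h hx => ⟨h, fun h' => hx h'.1⟩
    have hry : ∀ a b, r a b → b ≠ y → r' a b := fun a b h hx => ⟨h, fun h' => hx h'.2⟩
    have hlt : {p : α × α | r' p.1 p.2}.ncard < {p : α × α | r p.1 p.2}.ncard := by
      refine Set.ncard_lt_ncard ⟨fun p hp => hp.1, fun hsub => ?_⟩ (Set.toFinite _)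
      exact (hsub (show (x, y) ∈ {p : α × α | r p.1 p.2} from hxy)).2 ⟨rfl, rfl⟩
    have hswap : {p : α × α | Function.swap r' p.1 p.2}.ncard
        = {p : α × α | r' p.1 p.2}.ncard := by
      rw [← Set.ncard_image_of_injective _ Prod.swap_injective]
      congr 1
      ext ⟨a, b⟩
      simp [Function.swap]
    by_cases h' : ∀ X : Set α, X.ncard < k → ∃ a ∈ A, ∃ b ∈ B, ReachIn r' Xᶜ a b
    · obtain ⟨P, hP, hPr⟩ := ih _ hlt r' A B h' rfl
      refine ⟨P, hP, fun i => ?_⟩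
      obtain ⟨a, ha, b, hb, hab⟩ := hPr i
      exact ⟨a, ha, b, hb, hab.mono_rel hr'r⟩
    · push Not at h'
      obtain ⟨S, hSk, hS⟩ := h'
      have hS' : ∀ b ∈ B, ∀ a ∈ A, ¬ ReachIn (Function.swap r') Sᶜ b a :=
        fun b hb a ha hba => hS a ha b hb hba.swap
      have hrev : ∀ X : Set α, X.ncard < k →
          ∃ b ∈ B, ∃ a ∈ A, ReachIn (Function.swap r) Xᶜ b a := fun X hX =>
        let ⟨a, ha, b, hb, hab⟩ := h X hX
        ⟨b, hb, a, ha, hab.swap⟩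
      -- Both `insert x S` and `insert y S` separate `A` from `B` in `r`, so neither has fewer than
      -- `k` elements, while `S` has fewer.
      have card_of_sep : ∀ w, (w = x ∨ w = y) → w ∉ S ∧ (insert w S).ncard = k := by
        intro w hw
        have hge : ¬ (insert w S).ncard < k := by
          intro hlt
          obtain ⟨a, ha, b, hb, hab⟩ := h _ hlt
          refine hS a ha b hb ?_
          have : ReachIn r' (insert w S)ᶜ a b := by
            refine hab.rec_tail (p := fun v => ReachIn r' (insert w S)ᶜ a v) (.refl hab.1) ?_
            intro u v _ hu huv hv
            refine hu.tail ⟨huv, ?_⟩ hv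
            rintro ⟨rfl, rfl⟩
            rcases hw with rfl | rfl
            exacts [hu.right_mem (Set.mem_insert _ _), hv (Set.mem_insert _ _)]
          exact this.mono fun v hv hvS => hv (Set.mem_insert_of_mem _ hvS)
        have hwS : w ∉ S := fun hw => hge (by rwa [Set.insert_eq_of_mem hw])
        refine ⟨hwS, ?_⟩
        rw [Set.ncard_insert_of_notMem hwS (Set.toFinite _)] at hge ⊢
        omega
      obtain ⟨hxS, hxk⟩ := card_of_sep x (.inl rfl)
      obtain ⟨hyS, hyk⟩ := card_of_sep y (.inr rfl)
      obtain ⟨P, hP, hPr⟩ := ih _ hlt r' A (insert x S)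
        (fun X hX => exists_reachIn_insert hrx hS (h X hX)) rfl
      obtain ⟨Q, hQ, hQr⟩ := ih _ (hswap ▸ hlt) (Function.swap r') B (insert y S)
        (fun X hX => exists_reachIn_insert (fun a b hab ha => hry b a hab ha) hS' (hrev X hX)) rfl
      obtain ⟨U, hU1, hU2, hU3⟩ := exists_trimmed_walks hxk hP hPr
      obtain ⟨W, hW1, hW2, hW3⟩ := exists_trimmed_walks hyk hQ hQr
      classical
      let g : α → α := fun p => if p = x then y else p
      have hg : ∀ p ∈ insert x S, g p ∈ insert y S := by
        rintro p hp
        by_cases hpx : p = x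
        · simp [g, hpx]
        · simpa [g, hpx] using Or.inr (hp.resolve_left hpx)
      have hginj : ∀ p ∈ insert x S, ∀ q ∈ insert x S, p ≠ q → g p ≠ g q := by
        intro p hp q hq hpq
        by_cases hpx : p = x <;> by_cases hqx : q = x
        · exact absurd (hpx.trans hqx.symm) hpq
        · have := hq.resolve_left hqx
          simp only [g, hpx, hqx, if_true, if_false]
          rintro rfl
          exact hyS this
        · have := hp.resolve_left hpx
          simp only [g, hpx, hqx, if_true, if_false]
          rintro rfl
          exact hyS this
        · simpa [g, hpx, hqx] using hpq
      -- A first part and a second part can only meet in `S`, hence only in a common end.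
      have hcross : ∀ p ∈ insert x S, ∀ q ∈ insert x S, p ≠ q → Disjoint (U p) (W (g q)) := by
        intro p hp q hq hpq
        rw [Set.disjoint_left]
        intro v hv hv'
        by_cases hvS : v ∈ S
        · have e1 := (hU3 p hp v hv).1 hvS
          have e2 := (hW3 _ (hg q hq) v hv').1 hvS
          by_cases hqx : q = x
          · simp only [g, hqx, if_true] at e2
            exact hyS (e2 ▸ hvS)
          · simp only [g, hqx, if_false] at e2
            exact hpq (e1.symm.trans e2)
        · obtain ⟨a, ha, hav⟩ := (hU3 p hp v hv).2 hvS
          obtain ⟨b, hb, hbv⟩ := (hW3 _ (hg q hq) v hv').2 hvS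
          exact hS a ha b hb (hav.trans hbv.swap)
      have hcard : Nat.card (insert x S : Set α) = k := hxk
      let f : Fin k ≃ (insert x S : Set α) := (Finite.equivFinOfCardEq hcard).symm
      refine ⟨fun i => U (f i) ∪ W (g (f i)), ?_, ?_⟩
      · intro i j hij
        have hne : (f i : α) ≠ f j := fun h => hij (f.injective (Subtype.ext h))
        have hi := (f i).2
        have hj := (f j).2
        rw [Set.disjoint_union_left, Set.disjoint_union_right, Set.disjoint_union_right]
        exact ⟨⟨hU2 _ hi _ hj hne, hcross _ hi _ hj hne⟩, (hcross _ hj _ hi hne.symm).symm,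
          hW2 _ (hg _ hi) _ (hg _ hj) (hginj _ hi _ hj hne)⟩
      · intro i
        have hi := (f i).2
        obtain ⟨a, ha, h1⟩ := hU1 _ hi
        obtain ⟨b, hb, h2⟩ := hW1 _ (hg _ hi)
        refine ⟨a, ha, b, hb, ?_⟩
        have h1' := (h1.mono_rel hr'r).mono (Set.subset_union_left (t := W (g (f i))))
        have h2' := (h2.swap.mono_rel hr'r).mono (Set.subset_union_right (s := U (f i)))
        by_cases hx : (f i : α) = x
        · have hgx : g (f i) = y := by simp [g, hx]
          refine (h1'.tail (w := g (f i)) ?_ h2'.left_mem).trans h2'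
          rw [hgx, hx]
          exact hxy
        · have hgx : g (f i) = f i := by simp [g, hx]
          show ReachIn r (U (f i) ∪ W (g (f i))) a b
          rw [hgx] at h2' h1' ⊢
          exact h1'.trans h2'
  · push Not at hemp
    have hk : k ≤ (A ∩ B).ncard := by
      by_contra! hlt
      obtain ⟨a, ha, b, hb, hab⟩ := h _ hlt
      have : b = a := hab.rec_tail (p := fun v => v = a) rfl
        fun u v _ _ huv _ => absurd huv (hemp u v)
      subst this
      exact hab.1 ⟨ha, hb⟩
    obtain ⟨T, hT, hTk⟩ := Set.exists_subset_card_eq hk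
    let f : Fin k ≃ T := (Finite.equivFinOfCardEq (show Nat.card T = k from hTk)).symm
    refine ⟨fun i => {(f i : α)}, ?_, fun i => ?_⟩
    · intro i j hij
      rw [Set.disjoint_singleton]
      exact fun h => hij (f.injective (Subtype.ext h))
    · exact ⟨f i, (hT (f i).2).1, f i, (hT (f i).2).2, .refl rfl⟩

end Menger

/-! ### Connectors -/

section Connector

variable {α : Type*}

/-- `U` is a connector from `x` to `y` and `z`: a set avoiding these three vertices that contains an
out-neighbour of `x` from which in-neighbours of both `y` and `z` are reached inside `U`. The
vertices `x`, `y`, `z` need not be distinct. -/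
def IsConnector (r : α → α → Prop) (x y z : α) (U : Set α) : Prop :=
  x ∉ U ∧ y ∉ U ∧ z ∉ U ∧ ∃ s, r x s ∧ HitsIn r U s y ∧ HitsIn r U s z

/-- The vertices reached from `s` inside `U` carry a spanning out-tree rooted at `s`, given here by
a parent function `p` along which the rank `ρ` (the distance from `s`) decreases. -/
theorem exists_parent (r : α → α → Prop) (U : Set α) (s : α) :
    ∃ (p : α → α) (ρ : α → ℕ), ∀ v, ReachIn r U s v → v ≠ s →
      ReachIn r U s (p v) ∧ r (p v) v ∧ ρ (p v) < ρ v := by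
  classical
  -- `N n` consists of the ends of walks of length `n` from `s`.
  let N : ℕ → Set α := fun n => Nat.rec {v | v = s} (fun _ T => {v | v ∈ U ∧ ∃ u ∈ T, r u v}) n
  let ρ : α → ℕ := fun v => sInf {n | v ∈ N n}
  have hN : ∀ v, ReachIn r U s v → ∃ n, v ∈ N n := by
    intro v hv
    refine hv.rec_tail (p := fun v => ∃ n, v ∈ N n) ⟨0, rfl⟩ ?_
    rintro a b - ⟨n, hn⟩ hab hb
    exact ⟨n + 1, hb, a, hn, hab⟩
  have key : ∀ v, ∃ u, ReachIn r U s v → v ≠ s → ReachIn r U s u ∧ r u v ∧ ρ u < ρ v := by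
    intro v
    by_cases hv : ReachIn r U s v ∧ v ≠ s
    · obtain ⟨hv, hvs⟩ := hv
      have hmem : v ∈ N (ρ v) := Nat.sInf_mem (hN v hv)
      have hNr : ∀ n u, u ∈ N n → ReachIn r U s u := by
        intro n
        induction n with
        | zero =>
          rintro u (rfl : u = s)
          exact .refl hv.1
        | succ n ih =>
          rintro u ⟨hu, w, hw, hwu⟩
          exact (ih w hw).tail hwu hu
      cases hρ : ρ v with
      | zero =>
        rw [hρ] at hmem
        exact absurd hmem hvs
      | succ n =>
        rw [hρ] at hmem
        obtain ⟨-, u, hu, huv⟩ := hmem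
        exact ⟨u, fun _ _ => ⟨hNr n u hu, huv, Nat.lt_succ_of_le (Nat.sInf_le hu)⟩⟩
    · exact ⟨v, fun h1 h2 => absurd ⟨h1, h2⟩ hv⟩
  choose p hp using key
  exact ⟨p, ρ, hp⟩

end Connector

/-! ### Connectors and pendant trees -/

section Tree

variable {V : Type*} {D : Digraph V}

/-- The subdigraph on the vertex set `A` whose arcs run from `p v` to `v` for `v ∈ A`, `v ≠ r`. -/
def ofParent (D : Digraph V) (A : Set V) (r : V) (p : V → V)
    (h : ∀ v ∈ A, v ≠ r → p v ∈ A ∧ D.Adj (p v) v) : D.Subdigraph where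
  verts := A
  Arc u v := v ∈ A ∧ v ≠ r ∧ p v = u
  adj_of_arc := by
    rintro u v ⟨hv, hvr, rfl⟩
    exact (h v hv hvr).2
  left_mem := by
    rintro u v ⟨hv, hvr, rfl⟩
    exact (h v hv hvr).1
  right_mem := fun h => h.1

/-- If ranks decrease from each vertex to its parent, the parent function defines an out-tree. The
underlying graph is connected, since following parents leads to the root, and it has at most one
edge per non-root vertex. -/
theorem ofParent_isOutTree [Finite V] {A : Set V} {r : V} {p : V → V} {ρ : V → ℕ} (hr : r ∈ A)
    (h : ∀ v ∈ A, v ≠ r → p v ∈ A ∧ D.Adj (p v) v)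
    (hρ : ∀ v ∈ A, v ≠ r → ρ (p v) < ρ v) :
    (D.ofParent A r p h).IsOutTree r := by
  have hne : ∀ v ∈ A, v ≠ r → p v ≠ v := fun v hv hvr e => by
    have := hρ v hv hvr
    rw [e] at this
    exact this.false
  refine ⟨⟨?_, ?_⟩, hr, ?_⟩
  · rintro u v ⟨hv, hvr, hvu⟩ ⟨hu, hur, huv⟩
    have h1 := hρ v hv hvr
    have h2 := hρ u hu hur
    rw [hvu] at h1
    rw [huv] at h2
    omega
  · suffices hG : ∀ G : SimpleGraph A, (∀ a b, G.Adj a b ↔ a ≠ b ∧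
        (((b : V) ∈ A ∧ (b : V) ≠ r ∧ p b = a) ∨ ((a : V) ∈ A ∧ (a : V) ≠ r ∧ p a = b))) →
        G.IsTree from
      hG (D.ofParent A r p h).underlying fun a b => SimpleGraph.fromRel_adj _ a b
    intro G hG
    have hadj : ∀ (v : A) (hvr : (v : V) ≠ r),
        G.Adj ⟨p v, (h v v.2 hvr).1⟩ v := by
      intro v hvr
      rw [hG]
      exact ⟨fun e => hne v v.2 hvr (congrArg Subtype.val e), .inl ⟨v.2, hvr, rfl⟩⟩
    have hreach : ∀ n, ∀ v : A, ρ v = n → G.Reachable ⟨r, hr⟩ v := by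
      intro n
      induction n using Nat.strong_induction_on with
      | _ n ih =>
        intro v hv
        by_cases hvr : (v : V) = r
        · rw [show v = ⟨r, hr⟩ from Subtype.ext hvr]
        · exact (ih _ (hv ▸ hρ v v.2 hvr) ⟨p v, (h v v.2 hvr).1⟩ rfl).trans (hadj v hvr).reachable
    have hconn : G.Connected := by
      have : Nonempty A := ⟨⟨r, hr⟩⟩
      exact SimpleGraph.Connected.mk fun u v => (hreach _ u rfl).symm.trans (hreach _ v rfl)
    refine SimpleGraph.isTree_iff_connected_and_card.2
      ⟨hconn, le_antisymm ?_ hconn.card_vert_le_card_edgeSet_add_one⟩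
    let e : {v : A // v ≠ ⟨r, hr⟩} → G.edgeSet := fun v =>
      ⟨s(⟨p v.1, (h v.1 v.1.2 fun h' => v.2 (Subtype.ext h')).1⟩, v.1),
        hadj v.1 fun h' => v.2 (Subtype.ext h')⟩
    have he : Function.Surjective e := by
      rintro ⟨x, hx⟩
      induction x using Sym2.ind with
      | _ a b =>
        rw [SimpleGraph.mem_edgeSet, hG] at hx
        obtain ⟨-, ⟨-, hbr, hb⟩ | ⟨-, har, ha⟩⟩ := hx
        · refine ⟨⟨b, fun h' => hbr (congrArg Subtype.val h')⟩, Subtype.ext ?_⟩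
          simp only [e]
          rw [Sym2.eq_iff]
          exact .inl ⟨Subtype.ext hb, rfl⟩
        · refine ⟨⟨a, fun h' => har (congrArg Subtype.val h')⟩, Subtype.ext ?_⟩
          simp only [e]
          rw [Sym2.eq_iff]
          exact .inr ⟨Subtype.ext ha, rfl⟩
    have h1 := Nat.card_le_card_of_surjective e he
    have h2 : Nat.card {v : A // v ≠ ⟨r, hr⟩} + 1 = Nat.card A := by
      classical
      have := Fintype.ofFinite A
      rw [Nat.card_eq_fintype_card, Nat.card_eq_fintype_card, Fintype.card_subtype_compl]
      have : 0 < Fintype.card A := Fintype.card_pos_iff.2 ⟨⟨r, hr⟩⟩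
      simp only [Fintype.card_unique]
      omega
    omega
  · intro v hv
    by_cases hvr : v = r
    · have : {u | u ≠ v ∧ (D.ofParent A r p h).Arc u v} = ∅ :=
        Set.eq_empty_of_forall_notMem fun u hu => hu.2.2.1 hvr
      rw [Subdigraph.inDeg, this]
      simp [hvr]
    · have : {u | u ≠ v ∧ (D.ofParent A r p h).Arc u v} = {p v} := by
        ext u
        constructor
        · rintro ⟨-, -, -, h⟩
          exact h.symm
        · rintro rfl
          exact ⟨hne v hv hvr, hv, hvr, rfl⟩
      rw [Subdigraph.inDeg, this]
      simp [hvr]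

/-- A connector carries a pendant tree: a spanning out-tree of the part reached inside the connector
together with one arc for each of the three terminals. -/
theorem IsConnector.exists_isPendantTree [Finite V] [DecidableEq V] {x y z : V} (hxy : x ≠ y)
    (hxz : x ≠ z) (hyz : y ≠ z) {U : Set V} (hU : IsConnector D.Adj x y z U) :
    ∃ T : D.Subdigraph, T.IsPendantTree {x, y, z} x ∧ T.verts ⊆ U ∪ ({x, y, z} : Finset V) ∧
      ∀ u v, T.Arc u v → u ∈ U ∨ v ∈ U := by
  obtain ⟨hx, hy, hz, s, hxs, ⟨y', hy', hyy⟩, ⟨z', hz', hzz⟩⟩ := hU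
  obtain ⟨p, ρ, hp⟩ := exists_parent D.Adj U s
  have hRU : ∀ {v}, ReachIn D.Adj U s v → v ∈ U := fun h => h.right_mem
  have hsU : s ∈ U := hy'.1
  have hsR : ReachIn D.Adj U s s := .refl hsU
  have hsx : s ≠ x := fun h => hx (h ▸ hsU)
  have hsy : s ≠ y := fun h => hy (h ▸ hsU)
  have hsz : s ≠ z := fun h => hz (h ▸ hsU)
  -- The root of the tree is `x`, the parent of `s`; `y` and `z` hang on `y'` and `z'` as leaves, and
  -- ranks are shifted to make room for the root.
  let q : V → V := fun v => if v = y then y' else if v = z then z' else if v = s then x else p v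
  let σ : V → ℕ := fun v =>
    if v = x then 0 else if v = y then ρ y' + 2 else if v = z then ρ z' + 2 else ρ v + 1
  let A : Set V := {v | ReachIn D.Adj U s v} ∪ {x, y, z}
  have hUne : ∀ {v}, v ∈ U → v ≠ x ∧ v ≠ y ∧ v ≠ z := fun {v} h =>
    ⟨fun e => hx (e ▸ h), fun e => hy (e ▸ h), fun e => hz (e ▸ h)⟩
  have hqy : q y = y' := by simp [q]
  have hqz : q z = z' := by simp [q, hyz.symm]
  have hqs : q s = x := by simp [q, hsy, hsz]
  have hqR : ∀ {v}, ReachIn D.Adj U s v → v ≠ s → q v = p v := fun {v} h h' => by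
    obtain ⟨-, h2, h3⟩ := hUne (hRU h)
    simp [q, h2, h3, h']
  have hσU : ∀ {v}, v ∈ U → σ v = ρ v + 1 := fun {v} h => by
    obtain ⟨h1, h2, h3⟩ := hUne h
    simp [σ, h1, h2, h3]
  have hσx : σ x = 0 := by simp [σ]
  have hσy : σ y = ρ y' + 2 := by simp [σ, hxy.symm]
  have hσz : σ z = ρ z' + 2 := by simp [σ, hxz.symm, hyz.symm]
  have hA : ∀ v ∈ A, v ≠ x →
      v = y ∨ v = z ∨ v = s ∨ (ReachIn D.Adj U s v ∧ v ≠ s) := by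
    rintro v (hv | rfl | rfl | rfl) hvx
    · by_cases h : v = s
      exacts [.inr (.inr (.inl h)), .inr (.inr (.inr ⟨hv, h⟩))]
    · exact absurd rfl hvx
    · exact .inl rfl
    · exact .inr (.inl rfl)
  have hall : ∀ v ∈ A, v ≠ x → (q v ∈ A ∧ D.Adj (q v) v) ∧ σ (q v) < σ v := by
    intro v hv hvx
    obtain rfl | rfl | rfl | ⟨h1, h2⟩ := hA v hv hvx
    · rw [hqy, hσU (hRU hy'), hσy]
      exact ⟨⟨.inl hy', hyy⟩, by omega⟩
    · rw [hqz, hσU (hRU hz'), hσz]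
      exact ⟨⟨.inl hz', hzz⟩, by omega⟩
    · rw [hqs, hσU hsU, hσx]
      exact ⟨⟨.inr (.inl rfl), hxs⟩, by omega⟩
    · obtain ⟨h3, h4, h5⟩ := hp v h1 h2
      rw [hqR h1 h2, hσU (hRU h3), hσU (hRU h1)]
      exact ⟨⟨.inl h3, h4⟩, by omega⟩
  have hq : ∀ v ∈ A, v ≠ x → q v ∈ U ∨ (q v = x ∧ v = s) := by
    intro v hv hvx
    obtain rfl | rfl | rfl | ⟨h1, h2⟩ := hA v hv hvx
    · exact .inl (hqy ▸ hRU hy')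
    · exact .inl (hqz ▸ hRU hz')
    · exact .inr ⟨hqs, rfl⟩
    · exact .inl (hqR h1 h2 ▸ hRU (hp v h1 h2).1)
  have hxA : x ∈ A := .inr (.inl rfl)
  have htree := ofParent_isOutTree (D := D) hxA (fun v hv hvx => (hall v hv hvx).1)
    (fun v hv hvx => (hall v hv hvx).2)
  refine ⟨D.ofParent A x q fun v hv hvx => (hall v hv hvx).1, ⟨by simp, htree, ?_, ?_⟩, ?_, ?_⟩
  · intro v hv
    exact .inr (by simpa using hv)
  · have houtx : Subdigraph.outDeg (D.ofParent A x q fun v hv hvx => (hall v hv hvx).1) x = 1 := by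
      rw [Subdigraph.outDeg, Set.ncard_eq_one]
      refine ⟨s, ?_⟩
      ext v
      constructor
      · rintro ⟨-, hv, hvx, hqv⟩
        rcases hq v hv hvx with h | ⟨-, h⟩
        · exact absurd (hqv ▸ h) hx
        · exact h
      · rintro rfl
        exact ⟨hsx, .inl hsR, hsx, hqs⟩
    have hout : ∀ t, t ∉ U → t ≠ x →
        Subdigraph.outDeg (D.ofParent A x q fun v hv hvx => (hall v hv hvx).1) t = 0 := by
      intro t ht htx
      rw [Subdigraph.outDeg, Set.ncard_eq_zero]
      refine Set.eq_empty_of_forall_notMem ?_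
      rintro v ⟨-, hv, hvx, rfl⟩
      rcases hq v hv hvx with h | ⟨h, -⟩
      exacts [ht h, htx h]
    have hinx : Subdigraph.inDeg (D.ofParent A x q fun v hv hvx => (hall v hv hvx).1) x = 0 := by
      rw [Subdigraph.inDeg, Set.ncard_eq_zero]
      exact Set.eq_empty_of_forall_notMem fun u hu => hu.2.2.1 rfl
    intro v hv
    simp only [Finset.mem_insert, Finset.mem_singleton] at hv
    rw [Subdigraph.deg]
    rcases hv with rfl | rfl | rfl
    · rw [houtx, hinx]
    · rw [hout _ hy hxy.symm, (htree.2.2 _ (.inr (.inr (.inl rfl)))).2 hxy.symm]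
    · rw [hout _ hz hxz.symm, (htree.2.2 _ (.inr (.inr (.inr rfl)))).2 hxz.symm]
  · rintro v (hv | hv)
    · exact .inl (hRU hv)
    · exact .inr (by simpa using hv)
  · rintro u v ⟨hv, hvx, rfl⟩
    rcases hq v hv hvx with h | ⟨-, rfl⟩
    exacts [.inl h, .inr hsU]

/-- The inner vertices of a pendant tree form a connector. Every vertex of an out-tree is reached
from its root, and a terminal other than the root has no outgoing arc. -/
theorem Subdigraph.IsPendantTree.isConnector [Finite V] [DecidableEq V] {x y z : V}
    (hxy : x ≠ y) (hxz : x ≠ z) (hyz : y ≠ z) {T : D.Subdigraph}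
    (hT : T.IsPendantTree {x, y, z} x) :
    IsConnector D.Adj x y z (T.verts \ ({x, y, z} : Finset V)) := by
  obtain ⟨-, ⟨⟨hanti, htree⟩, hxT, hin⟩, hS, hdeg⟩ := hT
  have hloop : ∀ v, ¬ T.Arc v v := fun v h => hanti v v h h
  have hdegx := hdeg x (by simp)
  -- The root has in-degree different from one in an out-tree, and degree one, hence in-degree zero.
  have hinx : ∀ u, ¬ T.Arc u x := by
    intro u hu
    have h1 : T.inDeg x ≠ 1 := fun h => (hin x hxT).1 h rfl
    have h2 : 0 < T.inDeg x := by
      rw [Subdigraph.inDeg, Set.ncard_pos]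
      exact ⟨u, fun e => hloop _ (e ▸ hu), hu⟩
    rw [Subdigraph.deg] at hdegx
    omega
  have hout : ∀ t ∈ ({x, y, z} : Finset V), t ≠ x → ∀ v, ¬ T.Arc t v := by
    intro t ht htx v htv
    have h1 := hdeg t ht
    have h2 : T.inDeg t = 1 := (hin t (hS ht)).2 htx
    have h3 : 0 < T.outDeg t := by
      rw [Subdigraph.outDeg, Set.ncard_pos]
      exact ⟨v, fun e => hloop _ (e ▸ htv), htv⟩
    rw [Subdigraph.deg] at h1
    omega
  have huniq : ∀ {u v w}, T.Arc u w → T.Arc v w → u = v := by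
    intro u v w hu hv
    have hwx : w ≠ x := by
      rintro rfl
      exact hinx _ hu
    obtain ⟨c, hc⟩ := Set.ncard_eq_one.1 ((hin w (T.right_mem hu)).2 hwx)
    have h1 : u ∈ {a | a ≠ w ∧ T.Arc a w} := ⟨fun e => hloop _ (e ▸ hu), hu⟩
    have h2 : v ∈ {a | a ≠ w ∧ T.Arc a w} := ⟨fun e => hloop _ (e ▸ hv), hv⟩
    rw [hc] at h1 h2
    exact Eq.trans h1 (Eq.symm h2)
  -- The vertices reached from the root are closed under adjacency: an arc into one of them other
  -- than the root is the last arc of the walk that reaches it, since in-degrees are one.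
  have hreach : ∀ v ∈ T.verts, ReachIn T.Arc T.verts x v := by
    intro v hv
    have h1 := htree.1.preconnected ⟨x, hxT⟩ ⟨v, hv⟩
    rw [SimpleGraph.reachable_iff_reflTransGen] at h1
    have : ∀ w : T.verts, Relation.ReflTransGen T.underlying.Adj ⟨x, hxT⟩ w →
        ReachIn T.Arc T.verts x w := by
      intro w hw
      induction hw with
      | refl => exact .refl hxT
      | @tail b c _ hbc ih =>
        rw [Subdigraph.underlying, SimpleGraph.fromRel_adj] at hbc
        obtain ⟨-, hbc | hcb⟩ := hbc
        · exact ih.tail hbc c.2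
        · rcases Relation.ReflTransGen.cases_tail ih.2 with h | ⟨d, hd, hdb, -⟩
          · exact absurd (h ▸ hcb) (hinx _)
          · rw [huniq hcb hdb]
            exact ⟨hxT, hd⟩
    exact this _ h1
  obtain ⟨s, hs⟩ : ∃ s, {v | v ≠ x ∧ T.Arc x v} = {s} := by
    rw [← Set.ncard_eq_one]
    have : T.inDeg x = 0 := by
      rw [Subdigraph.inDeg, Set.ncard_eq_zero]
      exact Set.eq_empty_of_forall_notMem fun u hu => hinx _ hu.2
    rw [Subdigraph.deg, this] at hdegx
    exact hdegx
  have hxs : T.Arc x s := by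
    have : s ∈ {v | v ≠ x ∧ T.Arc x v} := hs ▸ rfl
    exact this.2
  have hsx : s ≠ x := fun e => hloop _ (e ▸ hxs)
  have honly : ∀ v, T.Arc x v → v = s := by
    intro v hv
    have : v ∈ {v | v ≠ x ∧ T.Arc x v} := ⟨fun e => hloop _ (e ▸ hv), hv⟩
    rw [hs] at this
    exact this
  have hmem : ∀ t, t ∈ ({x, y, z} : Finset V) ↔ t = x ∨ t = y ∨ t = z := by simp
  -- A terminal with no outgoing arc cannot be the only out-neighbour of the root.
  have hleaf : ∀ t ∈ ({x, y, z} : Finset V), t ≠ x → s = t → ∀ v ∈ T.verts, v = x ∨ v = t := by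
    rintro t ht htx rfl v hv
    refine (hreach v hv).rec_tail (p := fun v => v = x ∨ v = s) (.inl rfl) ?_
    rintro a b - (rfl | rfl) hab -
    exacts [.inr (honly _ hab), absurd hab (hout _ ht htx _)]
  have hyS : y ∈ ({x, y, z} : Finset V) := by simp
  have hzS : z ∈ ({x, y, z} : Finset V) := by simp
  have hsS : s ∉ ({x, y, z} : Finset V) := by
    intro h
    rcases (hmem s).1 h with h | h | h
    · exact hsx h
    · exact (hleaf y hyS hxy.symm h z (hS hzS)).elim hxz.symm hyz.symm
    · exact (hleaf z hzS hxz.symm h y (hS hyS)).elim hxy.symm hyz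
  have hhit : ∀ t ∈ ({x, y, z} : Finset V), t ≠ x →
      HitsIn D.Adj (T.verts \ ({x, y, z} : Finset V)) s t := by
    intro t ht htx
    -- A vertex reached from the root is the root itself, or lies inside, or is entered from inside.
    have key : t = x ∨ ReachIn D.Adj (T.verts \ ({x, y, z} : Finset V)) s t ∨
        HitsIn D.Adj (T.verts \ ({x, y, z} : Finset V)) s t := by
      refine (hreach t (hS ht)).rec_tail (p := fun t =>
        t = x ∨ ReachIn D.Adj (T.verts \ ({x, y, z} : Finset V)) s t ∨
        HitsIn D.Adj (T.verts \ ({x, y, z} : Finset V)) s t) (.inl rfl) ?_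
      rintro a b - ha hab hb
      by_cases hax : a = x
      · subst hax
        rw [honly b hab]
        exact .inr (.inl (.refl ⟨T.right_mem hxs, hsS⟩))
      have haS : a ∉ ({x, y, z} : Finset V) := fun h => hout a h hax b hab
      have hra : ReachIn D.Adj (T.verts \ ({x, y, z} : Finset V)) s a := by
        rcases ha.resolve_left hax with h | ⟨w, h1, h2⟩
        · exact h
        · exact h1.tail h2 ⟨T.left_mem hab, haS⟩
      exact .inr (.inr ⟨a, hra, T.adj_of_arc hab⟩)
    rcases key.resolve_left htx with h | h
    · exact absurd ht h.right_mem.2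
    · exact h
  exact ⟨fun h => h.2 (by simp), fun h => h.2 (by simp), fun h => h.2 (by simp), s,
    T.adj_of_arc hxs, hhit y hyS hxy.symm, hhit z hzS hxz.symm⟩

theorem IsConnector.nonempty {α : Type*} {r : α → α → Prop} {x y z : α} {U : Set α}
    (h : IsConnector r x y z U) : U.Nonempty :=
  let ⟨_, _, _, s, _, ⟨_, hs, _⟩, _⟩ := h
  ⟨s, hs.1⟩

/-- Families of internally-disjoint pendant trees correspond to families of disjoint connectors. -/
theorem exists_pendantTrees_iff [Finite V] [DecidableEq V] {x y z : V} (hxy : x ≠ y)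
    (hxz : x ≠ z) (hyz : y ≠ z) (n : ℕ) :
    (∃ T : Fin n → D.Subdigraph, (∀ i, (T i).IsPendantTree {x, y, z} x) ∧
      Pairwise fun i j => Subdigraph.InternallyDisjoint {x, y, z} (T i) (T j)) ↔
    ∃ U : Fin n → Set V, (∀ i, IsConnector D.Adj x y z (U i)) ∧
      Pairwise fun i j => Disjoint (U i) (U j) := by
  constructor
  · rintro ⟨T, hT, hdis⟩
    refine ⟨fun i => (T i).verts \ ({x, y, z} : Finset V),
      fun i => (hT i).isConnector hxy hxz hyz, fun i j hij => Set.disjoint_left.2 ?_⟩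
    rintro v ⟨h1, h2⟩ ⟨h3, -⟩
    exact h2 ((hdis hij).2 ▸ ⟨h1, h3⟩)
  · rintro ⟨U, hU, hdis⟩
    choose T hT hTv hTa using fun i => (hU i).exists_isPendantTree hxy hxz hyz
    have hUS : ∀ i, ∀ v ∈ U i, v ∉ ({x, y, z} : Finset V) := by
      intro i v hv hvS
      obtain ⟨hx, hy, hz, -⟩ := hU i
      simp only [Finset.mem_insert, Finset.mem_singleton] at hvS
      rcases hvS with rfl | rfl | rfl
      exacts [hx hv, hy hv, hz hv]
    have hinter : ∀ i j, i ≠ j → ∀ v ∈ U i, v ∉ (T j).verts := by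
      intro i j hij v hv hvT
      rcases hTv j hvT with h | h
      · exact Set.disjoint_left.1 (hdis hij) hv h
      · exact hUS i v hv h
    refine ⟨T, hT, fun i j hij => ⟨?_, ?_⟩⟩
    · rintro u v ⟨h1, h2⟩
      rcases hTa i u v h1 with h | h
      · exact hinter i j hij u h ((T j).left_mem h2)
      · exact hinter i j hij v h ((T j).right_mem h2)
    · refine Set.Subset.antisymm ?_ fun v hv => ⟨(hT i).2.2.1 hv, (hT j).2.2.1 hv⟩
      rintro v ⟨h1, h2⟩
      rcases hTv i h1 with h | h
      · exact absurd h2 (hinter i j hij v h)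
      · exact h

theorem le_localPendantTreeConnectivity_iff [Finite V] [DecidableEq V] {x y z : V} (hxy : x ≠ y)
    (hxz : x ≠ z) (hyz : y ≠ z) (n : ℕ) :
    n ≤ D.localPendantTreeConnectivity {x, y, z} x ↔
    ∃ U : Fin n → Set V, (∀ i, IsConnector D.Adj x y z (U i)) ∧
      Pairwise fun i j => Disjoint (U i) (U j) := by
  rw [localPendantTreeConnectivity]
  simp only [exists_pendantTrees_iff hxy hxz hyz]
  set N := {n | ∃ U : Fin n → Set V, (∀ i, IsConnector D.Adj x y z (U i)) ∧
      Pairwise fun i j => Disjoint (U i) (U j)} with hN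
  have hbdd : BddAbove N := by
    refine ⟨Nat.card V, ?_⟩
    rintro m ⟨U, hU, hdis⟩
    choose f hf using fun i => (hU i).nonempty
    have hinj : Function.Injective f := by
      intro i j hij
      by_contra hne
      exact Set.disjoint_left.1 (hdis hne) (hf i) (hij ▸ hf j)
    simpa using Nat.card_le_card_of_injective f hinj
  refine ⟨fun h => ?_, fun h => le_csSup hbdd h⟩
  obtain ⟨U, hU, hdis⟩ : sSup N ∈ N :=
    Nat.sSup_mem ⟨0, fun i => i.elim0, fun i => i.elim0, fun i => i.elim0⟩ hbdd
  exact ⟨fun i => U (i.castLE h), fun i => hU _,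
    fun i j hij => hdis fun e => hij (Fin.castLE_injective h e)⟩

theorem exists_connectors_of_le [Finite V] {n : ℕ} (hn : n ≤ D.pendantTreeConnectivity 3)
    {x y z : V} (hxy : x ≠ y) (hxz : x ≠ z) (hyz : y ≠ z) :
    ∃ U : Fin n → Set V, (∀ i, IsConnector D.Adj x y z (U i)) ∧
      Pairwise fun i j => Disjoint (U i) (U j) := by
  classical
  rw [← le_localPendantTreeConnectivity_iff hxy hxz hyz]
  refine hn.trans (Nat.sInf_le ⟨{x, y, z}, ?_, x, by simp, rfl⟩)
  exact Finset.card_eq_three.2 ⟨x, y, z, hxy, hxz, hyz, rfl⟩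

theorem three_le_card_of_pos [Finite V] (h : 0 < D.pendantTreeConnectivity 3) :
    3 ≤ Nat.card V := by
  obtain ⟨t, S, hS, -⟩ := Nat.nonempty_of_pos_sInf h
  have := Fintype.ofFinite V
  rw [Nat.card_eq_fintype_card, ← hS]
  exact Finset.card_le_univ S

theorem le_pendantTreeConnectivity [Finite V] {n : ℕ} (h3 : 3 ≤ Nat.card V)
    (h : ∀ x y z : V, x ≠ y → x ≠ z → y ≠ z →
      ∃ U : Fin n → Set V, (∀ i, IsConnector D.Adj x y z (U i)) ∧
        Pairwise fun i j => Disjoint (U i) (U j)) :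
    n ≤ D.pendantTreeConnectivity 3 := by
  classical
  have := Fintype.ofFinite V
  rw [Nat.card_eq_fintype_card] at h3
  obtain ⟨S, -, hS⟩ := Finset.exists_subset_card_eq (s := (Finset.univ : Finset V)) h3
  have hne : S.Nonempty := Finset.card_pos.1 (by omega)
  obtain ⟨r, hr⟩ := hne
  refine le_csInf ⟨_, S, hS, r, hr, rfl⟩ ?_
  rintro _ ⟨S, hS, x, hx, rfl⟩
  have h2 : (S.erase x).card = 2 := by rw [Finset.card_erase_of_mem hx, hS]
  obtain ⟨y, z, hyz, hS2⟩ := Finset.card_eq_two.1 h2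
  have hy : y ∈ S.erase x := by simp [hS2]
  have hz : z ∈ S.erase x := by simp [hS2]
  have hxy := (Finset.ne_of_mem_erase hy).symm
  have hxz := (Finset.ne_of_mem_erase hz).symm
  rw [show S = {x, y, z} by rw [← hS2, Finset.insert_erase hx]]
  exact (le_localPendantTreeConnectivity_iff hxy hxz hyz n).2 (h x y z hxy hxz hyz)

/-- If the two other terminals are all the out-neighbours of the root, there is no pendant tree. -/
theorem pendantTreeConnectivity_eq_zero [Finite V] {x y z : V} (hxy : x ≠ y) (hxz : x ≠ z)
    (hyz : y ≠ z) (h : ∀ v, D.Adj x v → v = y ∨ v = z) : D.pendantTreeConnectivity 3 = 0 := by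
  by_contra hne
  obtain ⟨U, hU, -⟩ := exists_connectors_of_le (Nat.one_le_iff_ne_zero.2 hne) hxy hxz hyz
  obtain ⟨-, hy, hz, s, hs, ⟨_, hs', -⟩, -⟩ := hU 0
  rcases h s hs with rfl | rfl
  exacts [hy hs'.1, hz hs'.1]

end Tree

/-! ### Deleting vertices, and fans -/

section Fan

variable {α : Type*}

theorem ReachIn.restrict {r : α → α → Prop} {U : Set α} {u v : α} (h : ReachIn r U u v) :
    ReachIn (fun a b => r a b ∧ a ∈ U ∧ b ∈ U) U u v :=
  h.rec_tail (p := ReachIn (fun a b => r a b ∧ a ∈ U ∧ b ∈ U) U u) (.refl h.1)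
    fun _ _ ha ih hr hb => ih.tail ⟨hr, ha.right_mem, hb⟩ hb

theorem ReachIn.inter_of_restrict {r : α → α → Prop} {G U : Set α} {u v : α}
    (h : ReachIn (fun a b => r a b ∧ a ∈ G ∧ b ∈ G) U u v) (hu : u ∈ G) :
    ReachIn r (U ∩ G) u v :=
  h.rec_tail (p := ReachIn r (U ∩ G) u) (.refl ⟨h.1, hu⟩)
    fun _ _ _ ih hr hb => ih.tail hr.1 ⟨hb, hr.2.2⟩

/-- Any two vertices are joined in both directions after the deletion of any `l` others: the digraph
is `(l + 1)`-strong, apart from its size. -/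
def StrongAfterDeleting (r : α → α → Prop) (l : ℕ) : Prop :=
  ∀ X : Set α, X.ncard ≤ l → ∀ u v, u ∉ X → v ∉ X → ReachIn r Xᶜ u v

theorem StrongAfterDeleting.swap {r : α → α → Prop} {l : ℕ} (h : StrongAfterDeleting r l) :
    StrongAfterDeleting (Function.swap r) l :=
  fun X hX u v hu hv => (h X hX v u hv hu).swap

/-- Some one of `l` disjoint connectors from `u` to `v` and `b` avoids a given set of `l` vertices
that contains `b`, since `b` lies in none of them. -/
theorem strongAfterDeleting_of_connectors [Finite α] {r : α → α → Prop} {l : ℕ}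
    (hs : ∀ u v, u ≠ v → Relation.ReflTransGen r u v)
    (hc : ∀ x y z : α, x ≠ y → x ≠ z → y ≠ z →
      ∃ U : Fin l → Set α, (∀ i, IsConnector r x y z (U i)) ∧
        Pairwise fun i j => Disjoint (U i) (U j)) :
    StrongAfterDeleting r l := by
  intro X hX u v hu hv
  by_cases huv : u = v
  · exact huv ▸ .refl hu
  rcases X.eq_empty_or_nonempty with rfl | ⟨b, hb⟩
  · exact ⟨hu, Relation.ReflTransGen.mono (fun _ b h => ⟨h, Set.notMem_empty b⟩) _ _ (hs u v huv)⟩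
  · have hub : u ≠ b := fun e => hu (e ▸ hb)
    have hvb : v ≠ b := fun e => hv (e ▸ hb)
    obtain ⟨U, hU, hdis⟩ := hc u v b huv hub hvb
    obtain ⟨i, hi⟩ : ∃ i, Disjoint (U i) X := by
      by_contra! hn
      simp only [Set.not_disjoint_iff] at hn
      choose f hf hfX using hn
      have hinj : Function.Injective f := by
        intro i j hij
        by_contra hne
        exact Set.disjoint_left.1 (hdis hne) (hf i) (hij ▸ hf j)
      have h1 : Set.range f ⊆ X \ {b} := by
        rintro _ ⟨i, rfl⟩
        refine ⟨hfX i, fun e => (hU i).2.2.1 ?_⟩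
        rw [← show f i = b from e]
        exact hf i
      have h2 := Set.ncard_le_ncard h1 (Set.toFinite _)
      rw [← Set.image_univ, Set.ncard_image_of_injective _ hinj, Set.ncard_univ, Nat.card_fin,
        Set.ncard_sdiff_singleton_of_mem hb] at h2
      have h3 : 0 < X.ncard := (Set.ncard_pos (Set.toFinite _)).2 ⟨b, hb⟩
      omega
    obtain ⟨-, -, -, s, hus, hsv, -⟩ := hU i
    have hsub : U i ⊆ Xᶜ := fun a ha haX => Set.disjoint_left.1 hi ha haX
    have hsX : s ∈ Xᶜ := by
      obtain ⟨w, hw, -⟩ := hsv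
      exact hsub hw.1
    exact ((ReachIn.refl hu).tail hus hsX).trans (hsv.reachIn hsub hv)

/-- The fan lemma: disjoint walks from `l` given vertices to the in-neighbours of `w`, avoiding `w`
and, if wanted, one further vertex. The ends may be prescribed because there are as many walks as
starting vertices. -/
theorem StrongAfterDeleting.exists_fan_to [Finite α] {r : α → α → Prop} {l : ℕ}
    (hr : StrongAfterDeleting r l) {s : Fin l → α} (hs : Function.Injective s) {w : α} {F : Set α}
    (hF : F.ncard ≤ 1) (hwF : w ∉ F) (hsF : ∀ j, s j ∉ F) (hsw : ∀ j, s j ≠ w) :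
    ∃ Q : Fin l → Set α, (∀ i j b, b ∈ Q i → b ∈ Q j → i = j) ∧
      ∀ j, w ∉ Q j ∧ (∀ b ∈ F, b ∉ Q j) ∧ HitsIn r (Q j) (s j) w := by
  have hsG : ∀ j, s j ∈ (insert w F)ᶜ := fun j h => h.elim (hsw j) (hsF j)
  obtain ⟨P, hP, hPr⟩ := exists_disjoint_walks l
    (fun a b => r a b ∧ a ∈ (insert w F)ᶜ ∧ b ∈ (insert w F)ᶜ) (Set.range s)
    {n | r n w} (by
      intro X hX
      have hcard : (Set.range s).ncard = l := by
        rw [← Set.image_univ, Set.ncard_image_of_injective _ hs, Set.ncard_univ, Nat.card_fin]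
      obtain ⟨_, ⟨j, rfl⟩, hj⟩ := Set.exists_mem_notMem_of_ncard_lt_ncard (hcard.symm ▸ hX)
        (Set.toFinite X)
      -- The walk to `w` is found in the complement of `F` and of the separator without `w`.
      have h1 : (X \ {w} ∪ F).ncard ≤ l := by
        have h2 := Set.ncard_union_le (X \ {w}) F
        have h3 := Set.ncard_le_ncard (Set.sdiff_subset (s := X) (t := {w})) (Set.toFinite X)
        omega
      have h4 := hr _ h1 (s j) w (fun h => h.elim (fun h => hj h.1) (hsF j))
        (fun h => h.elim (fun h => h.2 rfl) hwF)
      obtain ⟨n, h5, h6⟩ := h4.hitsIn_diff (hsw j)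
      have h7 : ∀ a ∈ (X \ {w} ∪ F)ᶜ \ {w}, a ∈ Xᶜ ∧ a ∈ (insert w F)ᶜ := by
        rintro a ⟨ha, haw⟩
        exact ⟨fun h => ha (.inl ⟨h, haw⟩), fun h => h.elim haw fun h => ha (.inr h)⟩
      refine ⟨s j, ⟨j, rfl⟩, n, h6, ?_⟩
      exact (h5.restrict.mono fun a ha => (h7 a ha).1).mono_rel
        fun a b hab => ⟨hab.1, (h7 a hab.2.1).2, (h7 b hab.2.2).2⟩)
  choose a ha n hn han using hPr
  choose σ hσ using ha
  have hinj : Function.Injective σ := by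
    intro i j hij
    by_contra hne
    refine Set.disjoint_left.1 (hP hne) (han i).1 ?_
    rw [← hσ i, hij, hσ j]
    exact (han j).1
  let e : Fin l ≃ Fin l := Equiv.ofBijective σ (Finite.injective_iff_bijective.1 hinj)
  have he : ∀ j, s j = a (e.symm j) := fun j => by
    rw [← hσ]
    exact congrArg s (e.apply_symm_apply j).symm
  refine ⟨fun j => P (e.symm j) ∩ (insert w F)ᶜ, ?_, fun j => ⟨fun h => h.2 (.inl rfl),
    fun b hb h => h.2 (.inr hb), n (e.symm j), ?_, hn _⟩⟩
  · intro i j b hi hj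
    by_contra hne
    exact Set.disjoint_left.1 (hP fun h => hne (e.symm.injective h)) hi.1 hj.1
  · rw [he]
    exact (han _).inter_of_restrict (he j ▸ hsG j)

theorem StrongAfterDeleting.exists_fan_from [Finite α] {r : α → α → Prop} {l : ℕ}
    (hr : StrongAfterDeleting r l) {s : Fin l → α} (hs : Function.Injective s) {w : α} {F : Set α}
    (hF : F.ncard ≤ 1) (hwF : w ∉ F) (hsF : ∀ j, s j ∉ F) (hsw : ∀ j, s j ≠ w) :
    ∃ Q : Fin l → Set α, (∀ i j b, b ∈ Q i → b ∈ Q j → i = j) ∧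
      ∀ j, w ∉ Q j ∧ (∀ b ∈ F, b ∉ Q j) ∧ ∃ u, r w u ∧ ReachIn r (Q j) u (s j) := by
  obtain ⟨Q, hQ, h⟩ := hr.swap.exists_fan_to hs hF hwF hsF hsw
  refine ⟨Q, hQ, fun j => ?_⟩
  obtain ⟨h1, h2, u, h3, h4⟩ := h j
  exact ⟨h1, h2, u, h4, h3.swap⟩

end Fan

/-! ### Routing inside one factor -/

section Routing

variable {α β : Type*}

/-- Walks in the second factor of a product from which `l` disjoint connectors from `x` to `y` and
`z` are assembled. The `i`-th one uses `X i` to get from the vertex `x.2` to the transfer vertex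
`s i` in the fibre over `x.1`, changes the first coordinate at `s i`, and then uses `Y i` and `Z i`
to get from `s i` to `y.2` and `z.2` in the fibres over `y.1` and `z.1`. Sets for different indices
have to be disjoint only where they are used in the same fibre. -/
structure Routing (r : β → β → Prop) (l : ℕ) (x y z : α × β) where
  s : Fin l → β
  X : Fin l → Set β
  Y : Fin l → Set β
  Z : Fin l → Set β
  eq_of_mem_X : ∀ i j b, b ∈ X i → b ∈ X j → i = j
  eq_of_mem_Y : ∀ i j b, b ∈ Y i → b ∈ Y j → i = j
  eq_of_mem_Z : ∀ i j b, b ∈ Z i → b ∈ Z j → i = j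
  eq_of_mem_XY : x.1 = y.1 → ∀ i j b, b ∈ X i → b ∈ Y j → i = j
  eq_of_mem_XZ : x.1 = z.1 → ∀ i j b, b ∈ X i → b ∈ Z j → i = j
  eq_of_mem_YZ : y.1 = z.1 → ∀ i j b, b ∈ Y i → b ∈ Z j → i = j
  avoid_X : ∀ i, x.2 ∉ X i ∧ y.2 ∉ X i ∧ z.2 ∉ X i
  avoid_Y : ∀ i, x.2 ∉ Y i ∧ y.2 ∉ Y i ∧ z.2 ∉ Y i
  avoid_Z : ∀ i, x.2 ∉ Z i ∧ y.2 ∉ Z i ∧ z.2 ∉ Z i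
  walk_X : ∀ i, ∃ u, r x.2 u ∧ ReachIn r (X i) u (s i)
  walk_Y : ∀ i, HitsIn r (Y i) (s i) y.2
  walk_Z : ∀ i, HitsIn r (Z i) (s i) z.2

namespace Routing

variable {r : β → β → Prop} {l : ℕ} {x y z : α × β}

/-- Exchange the two targets. -/
def symm (R : Routing r l x y z) : Routing r l x z y where
  s := R.s
  X := R.X
  Y := R.Z
  Z := R.Y
  eq_of_mem_X := R.eq_of_mem_X
  eq_of_mem_Y := R.eq_of_mem_Z
  eq_of_mem_Z := R.eq_of_mem_Y
  eq_of_mem_XY := R.eq_of_mem_XZ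
  eq_of_mem_XZ := R.eq_of_mem_XY
  eq_of_mem_YZ h i j b hi hj := (R.eq_of_mem_YZ h.symm j i b hj hi).symm
  avoid_X i := ⟨(R.avoid_X i).1, (R.avoid_X i).2.2, (R.avoid_X i).2.1⟩
  avoid_Y i := ⟨(R.avoid_Z i).1, (R.avoid_Z i).2.2, (R.avoid_Z i).2.1⟩
  avoid_Z i := ⟨(R.avoid_Y i).1, (R.avoid_Y i).2.2, (R.avoid_Y i).2.1⟩
  walk_X := R.walk_X
  walk_Y := R.walk_Z
  walk_Z := R.walk_Y

theorem s_mem_X (R : Routing r l x y z) (i : Fin l) : R.s i ∈ R.X i :=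
  let ⟨_, _, h⟩ := R.walk_X i
  h.right_mem

theorem s_mem_Y (R : Routing r l x y z) (i : Fin l) : R.s i ∈ R.Y i :=
  let ⟨_, h, _⟩ := R.walk_Y i
  h.1

theorem s_mem_Z (R : Routing r l x y z) (i : Fin l) : R.s i ∈ R.Z i :=
  let ⟨_, h, _⟩ := R.walk_Z i
  h.1

theorem s_ne (R : Routing r l x y z) (i : Fin l) : x.2 ≠ R.s i ∧ y.2 ≠ R.s i ∧ z.2 ≠ R.s i :=
  ⟨fun e => (R.avoid_X i).1 (e ▸ R.s_mem_X i), fun e => (R.avoid_X i).2.1 (e ▸ R.s_mem_X i),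
    fun e => (R.avoid_X i).2.2 (e ▸ R.s_mem_X i)⟩

end Routing

theorem exists_ne_ne [Finite β] (h : 3 ≤ Nat.card β) (a b : β) : ∃ t, t ≠ a ∧ t ≠ b := by
  by_contra! hn
  have h1 : (Set.univ : Set β) ⊆ {a, b} := fun t _ => by
    by_cases ht : t = a
    exacts [.inl ht, .inr (hn t ht)]
  have h2 := Set.ncard_le_ncard h1 (Set.toFinite _)
  have h3 := Set.ncard_insert_le a {b}
  rw [Set.ncard_univ] at h2
  rw [Set.ncard_singleton] at h3
  omega

/-- Routing when `x` and `y` have the same second coordinate and `z` another one. If `y` and `z`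
lie in the same fibre, the walks to them have to form connectors there, which start from an auxiliary
vertex `t`, and a fan leads from `x.2` to their first vertices. Otherwise connectors from `x.2` to
`z.2` serve `x` and `z`, and a fan leads from their first vertices back to `y.2 = x.2`. -/
theorem exists_routing_of_snd_eq [Finite β] {r : β → β → Prop} {l : ℕ} {x y z : α × β}
    (h3 : 3 ≤ Nat.card β) (hr : StrongAfterDeleting r l)
    (hc : ∀ x y z : β, x ≠ y → x ≠ z → y ≠ z →
      ∃ U : Fin l → Set β, (∀ i, IsConnector r x y z (U i)) ∧
        ∀ i j b, b ∈ U i → b ∈ U j → i = j)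
    (hxy : x.1 ≠ y.1) (h2 : x.2 = y.2) (hxz : x.2 ≠ z.2) : Nonempty (Routing r l x y z) := by
  obtain ⟨t, htx, htz⟩ := exists_ne_ne h3 x.2 z.2
  by_cases hyz : y.1 = z.1
  · obtain ⟨U, hU, hdis⟩ := hc t x.2 z.2 htx htz hxz
    choose ht hx hz s hs hsx hsz using hU
    have hsU : ∀ i, s i ∈ U i := fun i => let ⟨_, h, _⟩ := hsx i; h.1
    obtain ⟨Q, hQ, hQs⟩ := hr.exists_fan_from (s := s) (w := x.2) (F := {z.2})
      (fun i j e => hdis i j _ (hsU i) (e ▸ hsU j)) (by simp) hxz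
      (fun i e => hz i (e ▸ hsU i)) (fun i e => hx i (e ▸ hsU i))
    choose hQx hQz hQw using hQs
    exact ⟨{
      s := s, X := Q, Y := U, Z := U
      eq_of_mem_X := hQ, eq_of_mem_Y := hdis, eq_of_mem_Z := hdis
      eq_of_mem_XY := fun e => absurd e hxy
      eq_of_mem_XZ := fun e => absurd (e.trans hyz.symm) hxy
      eq_of_mem_YZ := fun _ => hdis
      avoid_X := fun i => ⟨hQx i, h2 ▸ hQx i, hQz i _ rfl⟩
      avoid_Y := fun i => ⟨hx i, h2 ▸ hx i, hz i⟩
      avoid_Z := fun i => ⟨hx i, h2 ▸ hx i, hz i⟩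
      walk_X := hQw, walk_Y := fun i => h2 ▸ hsx i, walk_Z := hsz }⟩
  · obtain ⟨U, hU, hdis⟩ := hc x.2 z.2 t hxz htx.symm htz.symm
    choose hx hz ht s hs hsz hst using hU
    have hsU : ∀ i, s i ∈ U i := fun i => let ⟨_, h, _⟩ := hsz i; h.1
    obtain ⟨Q, hQ, hQs⟩ := hr.exists_fan_to (s := s) (w := x.2) (F := {z.2})
      (fun i j e => hdis i j _ (hsU i) (e ▸ hsU j)) (by simp) hxz
      (fun i e => hz i (e ▸ hsU i)) (fun i e => hx i (e ▸ hsU i))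
    choose hQx hQz hQw using hQs
    exact ⟨{
      s := s, X := U, Y := Q, Z := U
      eq_of_mem_X := hdis, eq_of_mem_Y := hQ, eq_of_mem_Z := hdis
      eq_of_mem_XY := fun e => absurd e hxy
      eq_of_mem_XZ := fun _ => hdis
      eq_of_mem_YZ := fun e => absurd e hyz
      avoid_X := fun i => ⟨hx i, h2 ▸ hx i, hz i⟩
      avoid_Y := fun i => ⟨hQx i, h2 ▸ hQx i, hQz i _ rfl⟩
      avoid_Z := fun i => ⟨hx i, h2 ▸ hx i, hz i⟩
      walk_X := fun i => ⟨s i, hs i, .refl (hsU i)⟩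
      walk_Y := fun i => h2 ▸ hQw i, walk_Z := hsz }⟩

/-- Routing exists for any three distinct vertices of the product, if the second factor has `l`
disjoint connectors for any three distinct vertices of its own. Where second coordinates coincide,
connectors for other vertices are combined with fans. -/
theorem exists_routing [Finite β] {r : β → β → Prop} {l : ℕ} {x y z : α × β}
    (h3 : 0 < l → 3 ≤ Nat.card β) (hr : StrongAfterDeleting r l)
    (hc : ∀ x y z : β, x ≠ y → x ≠ z → y ≠ z →
      ∃ U : Fin l → Set β, (∀ i, IsConnector r x y z (U i)) ∧
        ∀ i j b, b ∈ U i → b ∈ U j → i = j)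
    (hxy : x ≠ y) (hxz : x ≠ z) (hyz : y ≠ z) : Nonempty (Routing r l x y z) := by
  rcases Nat.eq_zero_or_pos l with rfl | hl
  · exact ⟨{
      s := fun i => i.elim0, X := fun i => i.elim0, Y := fun i => i.elim0, Z := fun i => i.elim0
      eq_of_mem_X := fun i => i.elim0, eq_of_mem_Y := fun i => i.elim0
      eq_of_mem_Z := fun i => i.elim0, eq_of_mem_XY := fun _ i => i.elim0
      eq_of_mem_XZ := fun _ i => i.elim0, eq_of_mem_YZ := fun _ i => i.elim0
      avoid_X := fun i => i.elim0, avoid_Y := fun i => i.elim0, avoid_Z := fun i => i.elim0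
      walk_X := fun i => i.elim0, walk_Y := fun i => i.elim0, walk_Z := fun i => i.elim0 }⟩
  replace h3 := h3 hl
  have hfst : ∀ {a b : α × β}, a ≠ b → a.2 = b.2 → a.1 ≠ b.1 :=
    fun h h2 h1 => h (Prod.ext h1 h2)
  by_cases hxy2 : x.2 = y.2
  · by_cases hxz2 : x.2 = z.2
    · obtain ⟨t, htx, -⟩ := exists_ne_ne h3 x.2 x.2
      obtain ⟨t', htx', htt'⟩ := exists_ne_ne h3 x.2 t
      obtain ⟨U, hU, hdis⟩ := hc x.2 t t' htx.symm htx'.symm htt'.symm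
      choose hx _ _ s hs hst _ using hU
      have hsU : ∀ i, s i ∈ U i := fun i => let ⟨_, h, _⟩ := hst i; h.1
      obtain ⟨Q, hQ, hQs⟩ := hr.exists_fan_to (s := s) (w := x.2) (F := ∅)
        (fun i j e => hdis i j _ (hsU i) (e ▸ hsU j)) (by simp) (Set.notMem_empty _)
        (fun i => Set.notMem_empty _) (fun i e => hx i (e ▸ hsU i))
      choose hQx _ hQw using hQs
      exact ⟨{
        s := s, X := U, Y := Q, Z := Q
        eq_of_mem_X := hdis, eq_of_mem_Y := hQ, eq_of_mem_Z := hQ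
        eq_of_mem_XY := fun e => absurd e (hfst hxy hxy2)
        eq_of_mem_XZ := fun e => absurd e (hfst hxz hxz2)
        eq_of_mem_YZ := fun e => absurd e (hfst hyz (hxy2.symm.trans hxz2))
        avoid_X := fun i => ⟨hx i, hxy2 ▸ hx i, hxz2 ▸ hx i⟩
        avoid_Y := fun i => ⟨hQx i, hxy2 ▸ hQx i, hxz2 ▸ hQx i⟩
        avoid_Z := fun i => ⟨hQx i, hxy2 ▸ hQx i, hxz2 ▸ hQx i⟩
        walk_X := fun i => ⟨s i, hs i, .refl (hsU i)⟩
        walk_Y := fun i => hxy2 ▸ hQw i, walk_Z := fun i => hxz2 ▸ hQw i }⟩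
    · exact exists_routing_of_snd_eq h3 hr hc (hfst hxy hxy2) hxy2 hxz2
  by_cases hxz2 : x.2 = z.2
  · exact (exists_routing_of_snd_eq h3 hr hc (hfst hxz hxz2) hxz2 hxy2).map Routing.symm
  obtain ⟨U, hU, hdis⟩ : ∃ U : Fin l → Set β,
      (∀ i, x.2 ∉ U i ∧ y.2 ∉ U i ∧ z.2 ∉ U i ∧
        ∃ s, r x.2 s ∧ HitsIn r (U i) s y.2 ∧ HitsIn r (U i) s z.2) ∧
      ∀ i j b, b ∈ U i → b ∈ U j → i = j := by
    by_cases hyz2 : y.2 = z.2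
    · obtain ⟨t, htx, hty⟩ := exists_ne_ne h3 x.2 y.2
      obtain ⟨U, hU, hdis⟩ := hc x.2 y.2 t hxy2 htx.symm hty.symm
      refine ⟨U, fun i => ?_, hdis⟩
      obtain ⟨h1, h2, -, s, h4, h5, -⟩ := hU i
      exact ⟨h1, h2, hyz2 ▸ h2, s, h4, h5, hyz2 ▸ h5⟩
    · exact hc x.2 y.2 z.2 hxy2 hxz2 hyz2
  choose hx hy hz s hs hsy hsz using hU
  have hav : ∀ i, x.2 ∉ U i ∧ y.2 ∉ U i ∧ z.2 ∉ U i := fun i => ⟨hx i, hy i, hz i⟩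
  exact ⟨{
    s := s, X := U, Y := U, Z := U
    eq_of_mem_X := hdis, eq_of_mem_Y := hdis, eq_of_mem_Z := hdis
    eq_of_mem_XY := fun _ => hdis, eq_of_mem_XZ := fun _ => hdis, eq_of_mem_YZ := fun _ => hdis
    avoid_X := hav, avoid_Y := hav, avoid_Z := hav
    walk_X := fun i => ⟨s i, hs i, .refl (let ⟨_, h, _⟩ := hsy i; h.1)⟩
    walk_Y := hsy, walk_Z := hsz }⟩

end Routing

/-! ### Connectors in the Cartesian product -/

section BoxProd

variable {V W : Type*}

/-- The `i`-th connector in the product built from a routing `F`, where `R` is the set of first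
coordinates used for the transfer at `F.s i`. -/
def Routing.spread {r : W → W → Prop} {l : ℕ} {x y z : V × W} (F : Routing r l x y z) (R : Set V)
    (i : Fin l) : Set (V × W) :=
  {p | (p.1 = x.1 ∧ p.2 ∈ F.X i) ∨ (p.1 ∈ R ∧ p.2 = F.s i) ∨ (p.1 = y.1 ∧ p.2 ∈ F.Y i) ∨
    (p.1 = z.1 ∧ p.2 ∈ F.Z i)}

theorem Routing.isConnector_spread {D : Digraph V} {H : Digraph W} {l : ℕ} {x y z : V × W}
    (F : Routing H.Adj l x y z) {R : Set V} (hy : ReachIn D.Adj R x.1 y.1)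
    (hz : ReachIn D.Adj R x.1 z.1) (i : Fin l) :
    IsConnector (D.boxProd H).Adj x y z (F.spread R i) := by
  have hne := F.s_ne i
  have hX := F.avoid_X i
  have hY := F.avoid_Y i
  have hZ := F.avoid_Z i
  have hv : ∀ (c : V) (a b : W), H.Adj a b → (D.boxProd H).Adj (c, a) (c, b) :=
    fun c a b h => .inr ⟨rfl, h⟩
  have hh : ∀ (c : W) (a b : V), D.Adj a b → (D.boxProd H).Adj (a, c) (b, c) :=
    fun c a b h => .inl ⟨h, rfl⟩
  obtain ⟨u, hu, hus⟩ := F.walk_X i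
  have h1 : ReachIn (D.boxProd H).Adj (F.spread R i) (x.1, u) (x.1, F.s i) :=
    hus.map (f := fun b => (x.1, b)) (hv x.1) fun b hb => .inl ⟨rfl, hb⟩
  have h2 : ∀ c, ReachIn D.Adj R x.1 c →
      ReachIn (D.boxProd H).Adj (F.spread R i) (x.1, F.s i) (c, F.s i) := fun c hc =>
    hc.map (f := fun a => (a, F.s i)) (hh _) fun a ha => .inr (.inl ⟨ha, rfl⟩)
  refine ⟨?_, ?_, ?_, (x.1, u), hv _ _ _ hu, ?_, ?_⟩
  · rintro (h | h | h | h)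
    exacts [hX.1 h.2, hne.1 h.2, hY.1 h.2, hZ.1 h.2]
  · rintro (h | h | h | h)
    exacts [hX.2.1 h.2, hne.2.1 h.2, hY.2.1 h.2, hZ.2.1 h.2]
  · rintro (h | h | h | h)
    exacts [hX.2.2 h.2, hne.2.2 h.2, hY.2.2 h.2, hZ.2.2 h.2]
  · obtain ⟨w, hw, hwy⟩ := F.walk_Y i
    exact ⟨(y.1, w), (h1.trans (h2 _ hy)).trans (hw.map (f := fun b => (y.1, b)) (hv y.1)
      fun b hb => .inr (.inr (.inl ⟨rfl, hb⟩))), hv _ _ _ hwy⟩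
  · obtain ⟨w, hw, hwz⟩ := F.walk_Z i
    exact ⟨(z.1, w), (h1.trans (h2 _ hz)).trans (hw.map (f := fun b => (z.1, b)) (hv z.1)
      fun b hb => .inr (.inr (.inr ⟨rfl, hb⟩))), hv _ _ _ hwz⟩

theorem Routing.eq_of_mem_spread {r : W → W → Prop} {l : ℕ} {x y z : V × W}
    (F : Routing r l x y z) {R : Set V} {i j : Fin l} {p : V × W} (hi : p ∈ F.spread R i)
    (hj : p ∈ F.spread R j) : i = j := by
  have hs : p.2 = F.s i → p.2 ∈ F.X i ∧ p.2 ∈ F.Y i ∧ p.2 ∈ F.Z i := fun h => by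
    rw [h]
    exact ⟨F.s_mem_X i, F.s_mem_Y i, F.s_mem_Z i⟩
  have hs' : p.2 = F.s j → p.2 ∈ F.X j ∧ p.2 ∈ F.Y j ∧ p.2 ∈ F.Z j := fun h => by
    rw [h]
    exact ⟨F.s_mem_X j, F.s_mem_Y j, F.s_mem_Z j⟩
  have hX := F.eq_of_mem_X i j p.2
  have hY := F.eq_of_mem_Y i j p.2
  have hZ := F.eq_of_mem_Z i j p.2
  have hXY := fun h => F.eq_of_mem_XY h i j p.2
  have hXZ := fun h => F.eq_of_mem_XZ h i j p.2
  have hYZ := fun h => F.eq_of_mem_YZ h i j p.2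
  have hYX := fun h => F.eq_of_mem_XY h j i p.2
  have hZX := fun h => F.eq_of_mem_XZ h j i p.2
  have hZY := fun h => F.eq_of_mem_YZ h j i p.2
  simp only [Routing.spread, Set.mem_ofPred_eq] at hi hj
  grind

theorem IsConnector.swap {D : Digraph V} {H : Digraph W} {x y z : V × W} {U : Set (W × V)}
    (h : IsConnector (H.boxProd D).Adj x.swap y.swap z.swap U) :
    IsConnector (D.boxProd H).Adj x y z (Prod.swap ⁻¹' U) := by
  have hadj : ∀ p q, (H.boxProd D).Adj p q → (D.boxProd H).Adj p.swap q.swap := by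
    rintro p q (⟨h1, h2⟩ | ⟨h1, h2⟩)
    exacts [.inr ⟨h2, h1⟩, .inl ⟨h2, h1⟩]
  have hhit : ∀ s t : W × V, HitsIn (H.boxProd D).Adj U s t →
      HitsIn (D.boxProd H).Adj (Prod.swap ⁻¹' U) s.swap t.swap := by
    rintro s t ⟨w, h1, h2⟩
    exact ⟨w.swap, h1.map hadj fun a ha => by simpa using ha, hadj _ _ h2⟩
  obtain ⟨h1, h2, h3, s, h4, h5, h6⟩ := h
  exact ⟨h1, h2, h3, s.swap, hadj _ _ h4, hhit _ _ h5, hhit _ _ h6⟩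

/-- Connectors from the two factors are disjoint once those from the first factor change their
second coordinate outside the transfer vertices of those from the second factor: everything else
of a connector lies over the terminals, which the sets of a routing avoid. -/
theorem Routing.notMem_spread {D : Digraph V} {H : Digraph W} {k l : ℕ} {x y z : V × W}
    (F : Routing H.Adj l x y z) (G : Routing D.Adj k x.swap y.swap z.swap) {R : Set V}
    {R' : Set W} (hR' : ∀ j, F.s j ∉ R') {i : Fin k} {j : Fin l} {p : V × W}
    (hj : p ∈ F.spread R j) : p.swap ∉ G.spread R' i := by
  intro hi
  have h1 := F.avoid_X j
  have h2 := F.avoid_Y j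
  have h3 := F.avoid_Z j
  have h4 := F.s_ne j
  have h5 := G.avoid_X i
  have h6 := G.avoid_Y i
  have h7 := G.avoid_Z i
  have h8 := G.s_ne i
  have h9 := hR' j
  obtain ⟨a, b⟩ := p
  simp only [Routing.spread, Set.mem_ofPred_eq, Prod.fst_swap, Prod.snd_swap] at *
  grind

/-- The connectors of the two routings together, as one family of `k + l` disjoint connectors. -/
theorem exists_connectors_boxProd [Finite V] [Finite W] {D : Digraph V} {H : Digraph W} {k l : ℕ}
    {x y z : V × W} (hD : StrongAfterDeleting D.Adj k) (hH : StrongAfterDeleting H.Adj l)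
    (G : Routing D.Adj k x.swap y.swap z.swap) (F : Routing H.Adj l x y z) :
    ∃ U : Fin (k + l) → Set (V × W), (∀ i, IsConnector (D.boxProd H).Adj x y z (U i)) ∧
      Pairwise fun i j => Disjoint (U i) (U j) := by
  have hV : ∀ c, ReachIn D.Adj Set.univ x.1 c := fun c =>
    (hD ∅ (by simp) x.1 c (Set.notMem_empty _) (Set.notMem_empty _)).mono (Set.subset_univ _)
  have hcard : (Set.range F.s).ncard ≤ l := by
    have := Set.ncard_image_le (s := Set.univ) (f := F.s) (Set.toFinite _)
    rwa [Set.image_univ, Set.ncard_univ, Nat.card_fin] at this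
  have hW : ∀ c, c ∉ Set.range F.s → ReachIn H.Adj (Set.range F.s)ᶜ x.2 c := fun c hc =>
    hH _ hcard x.2 c (by rintro ⟨j, hj⟩; exact (F.s_ne j).1 hj.symm) hc
  have hy : y.2 ∉ Set.range F.s := by rintro ⟨j, hj⟩; exact (F.s_ne j).2.1 hj.symm
  have hz : z.2 ∉ Set.range F.s := by rintro ⟨j, hj⟩; exact (F.s_ne j).2.2 hj.symm
  have hR' : ∀ j, F.s j ∉ (Set.range F.s)ᶜ := fun j h => h ⟨j, rfl⟩
  let T : Fin k ⊕ Fin l → Set (V × W) :=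
    Sum.elim (fun i => Prod.swap ⁻¹' G.spread (Set.range F.s)ᶜ i) (fun j => F.spread Set.univ j)
  have hT : ∀ i, IsConnector (D.boxProd H).Adj x y z (T i) := by
    rintro (i | j)
    · exact (G.isConnector_spread (hW _ hy) (hW _ hz) i).swap
    · exact F.isConnector_spread (hV _) (hV _) j
  have hdis : ∀ i j p, p ∈ T i → p ∈ T j → i = j := by
    rintro (i | i) (j | j) p hi hj
    · exact congrArg _ (G.eq_of_mem_spread hi hj)
    · exact absurd hi (F.notMem_spread G hR' hj)
    · exact absurd hj (F.notMem_spread G hR' hi)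
    · exact congrArg _ (F.eq_of_mem_spread hi hj)
  exact ⟨fun i => T (finSumFinEquiv.symm i), fun i => hT _, fun i j hij =>
    Set.disjoint_left.2 fun p hi hj => hij (finSumFinEquiv.symm.injective (hdis _ _ p hi hj))⟩

theorem IsStrong.strongAfterDeleting [Finite V] {D : Digraph V} (hD : D.IsStrong) :
    StrongAfterDeleting D.Adj (D.pendantTreeConnectivity 3) :=
  strongAfterDeleting_of_connectors hD fun _ _ _ => exists_connectors_of_le le_rfl

/-- A routing in the second factor of a product, for as many connectors as there are pendant trees
in that factor. -/
theorem IsStrong.exists_routing [Finite W] {H : Digraph W} (hH : H.IsStrong) {x y z : V × W}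
    (hxy : x ≠ y) (hxz : x ≠ z) (hyz : y ≠ z) :
    Nonempty (Routing H.Adj (H.pendantTreeConnectivity 3) x y z) := by
  refine Digraph.exists_routing three_le_card_of_pos hH.strongAfterDeleting ?_ hxy hxz hyz
  intro a b c hab hac hbc
  obtain ⟨U, hU, hdis⟩ := exists_connectors_of_le (D := H) le_rfl hab hac hbc
  refine ⟨U, hU, fun i j b hi hj => ?_⟩
  by_contra hne
  exact Set.disjoint_left.1 (hdis hne) hi hj

theorem add_le_pendantTreeConnectivity_boxProd [Finite V] [Finite W] [Nonempty V] [Nonempty W]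
    {D : Digraph V} {H : Digraph W} (hD : D.IsStrong) (hH : H.IsStrong) :
    D.pendantTreeConnectivity 3 + H.pendantTreeConnectivity 3 ≤
      (D.boxProd H).pendantTreeConnectivity 3 := by
  rcases Nat.eq_zero_or_pos (D.pendantTreeConnectivity 3 + H.pendantTreeConnectivity 3)
    with h0 | hpos
  · omega
  refine le_pendantTreeConnectivity ?_ ?_
  · rw [Nat.card_prod]
    have hV : 0 < Nat.card V := Nat.card_pos
    have hW : 0 < Nat.card W := Nat.card_pos
    rcases Nat.eq_zero_or_pos (D.pendantTreeConnectivity 3) with h | h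
    · have := three_le_card_of_pos (D := H) (by omega)
      nlinarith
    · have := three_le_card_of_pos h
      nlinarith
  · intro x y z hxy hxz hyz
    obtain ⟨F⟩ := hH.exists_routing hxy hxz hyz
    obtain ⟨G⟩ := hD.exists_routing (Prod.swap_injective.ne hxy) (Prod.swap_injective.ne hxz)
      (Prod.swap_injective.ne hyz)
    exact exists_connectors_boxProd hD.strongAfterDeleting hH.strongAfterDeleting G F

end BoxProd

/-! ### The path and the directed cycle -/

section Examples

theorem loopless_symmPath (n : ℕ) : (symmPath n).Loopless := by
  rintro v (h | h) <;> omega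

theorem loopless_dirCycle {m : ℕ} (hm : 2 ≤ m) : (dirCycle m).Loopless := by
  intro v h
  have hv := v.2
  change (v.val + 1) % m = v.val at h
  rcases Nat.lt_or_ge (v.val + 1) m with h1 | h1
  · rw [Nat.mod_eq_of_lt h1] at h
    omega
  · rw [show v.val + 1 = m by omega, Nat.mod_self] at h
    omega

theorem isStrong_symmPath (n : ℕ) : (symmPath n).IsStrong := by
  have key : ∀ d (u v : Fin n), (u : ℕ) + d = v →
      Relation.ReflTransGen (symmPath n).Adj u v ∧ Relation.ReflTransGen (symmPath n).Adj v u := by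
    intro d
    induction d with
    | zero =>
      intro u v h
      rw [show u = v from Fin.ext h]
      exact ⟨.refl, .refl⟩
    | succ d ih =>
      intro u v h
      have hv := v.2
      obtain ⟨h1, h2⟩ := ih u ⟨u + d, by omega⟩ rfl
      exact ⟨h1.tail (.inl (by simp only; omega)), .head (.inr (by simp only; omega)) h2⟩
  intro u v _
  rcases Nat.le_total u v with h | h
  · exact (key (v - u) u v (by omega)).1
  · exact (key (u - v) v u (by omega)).2

theorem isStrong_dirCycle (m : ℕ) : (dirCycle m).IsStrong := by
  have key : ∀ d (u v : Fin m), ((u : ℕ) + d) % m = v →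
      Relation.ReflTransGen (dirCycle m).Adj u v := by
    intro d
    induction d with
    | zero =>
      intro u v h
      rw [Nat.add_zero, Nat.mod_eq_of_lt u.2] at h
      rw [show u = v from Fin.ext h]
    | succ d ih =>
      intro u v h
      refine (ih u ⟨(u + d) % m, Nat.mod_lt _ (by have := u.2; omega)⟩ rfl).tail ?_
      change ((u + d) % m + 1) % m = v
      rw [Nat.mod_add_mod, ← h, Nat.add_assoc]
  intro u v _
  refine key (v + m - u) u v ?_
  rw [show (u : ℕ) + (v + m - u) = v + m by have := u.2; omega, Nat.add_mod_right,
    Nat.mod_eq_of_lt v.2]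

theorem symmPath_adj_zero {n : ℕ} (hn : 3 ≤ n) {v : Fin n}
    (h : (symmPath n).Adj ⟨0, by omega⟩ v) : v = ⟨1, by omega⟩ := by
  apply Fin.ext
  rcases h with h | h <;> simp only at h ⊢ <;> omega

theorem dirCycle_adj_zero {m : ℕ} (hm : 3 ≤ m) {v : Fin m}
    (h : (dirCycle m).Adj ⟨0, by omega⟩ v) : v = ⟨1, by omega⟩ := by
  apply Fin.ext
  change (0 + 1) % m = v.val at h
  rw [Nat.mod_eq_of_lt (by omega)] at h
  exact h.symm

theorem pendantTreeConnectivity_symmPath {n : ℕ} (hn : 3 ≤ n) :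
    (symmPath n).pendantTreeConnectivity 3 = 0 :=
  pendantTreeConnectivity_eq_zero (x := ⟨0, by omega⟩) (y := ⟨1, by omega⟩) (z := ⟨2, by omega⟩)
    (by simp) (by simp) (by simp) fun _ h => .inl (symmPath_adj_zero hn h)

theorem pendantTreeConnectivity_dirCycle {m : ℕ} (hm : 3 ≤ m) :
    (dirCycle m).pendantTreeConnectivity 3 = 0 :=
  pendantTreeConnectivity_eq_zero (x := ⟨0, by omega⟩) (y := ⟨1, by omega⟩) (z := ⟨2, by omega⟩)
    (by simp) (by simp) (by simp) fun _ h => .inl (dirCycle_adj_zero hm h)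

theorem pendantTreeConnectivity_symmPath_boxProd_dirCycle {n m : ℕ} (hn : 3 ≤ n) (hm : 3 ≤ m) :
    ((symmPath n).boxProd (dirCycle m)).pendantTreeConnectivity 3 = 0 := by
  refine pendantTreeConnectivity_eq_zero (x := (⟨0, by omega⟩, ⟨0, by omega⟩))
    (y := (⟨1, by omega⟩, ⟨0, by omega⟩)) (z := (⟨0, by omega⟩, ⟨1, by omega⟩))
    (by simp) (by simp) (by simp) ?_
  rintro ⟨a, b⟩ (⟨h1, h2⟩ | ⟨h1, h2⟩)
  · exact .inl (Prod.ext (symmPath_adj_zero hn h1) h2.symm)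
  · exact .inr (Prod.ext h1.symm (dirCycle_adj_zero hm h2))

end Examples

end Digraph

theorem theorem1p1 :
    (∀ {V W : Type*} [Finite V] [Finite W] [Nonempty V] [Nonempty W]
      (D : Digraph V) (H : Digraph W),
      D.Loopless → H.Loopless → D.IsStrong → H.IsStrong →
        (D.boxProd H).pendantTreeConnectivity 3 ≥
          D.pendantTreeConnectivity 3 + H.pendantTreeConnectivity 3) ∧
    -- sharpness: equality holds for the symmetric path times the directed cycle
    (∀ n m : ℕ, 3 ≤ n → 3 ≤ m →
      (Digraph.symmPath n).Loopless ∧ (Digraph.dirCycle m).Loopless ∧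
      (Digraph.symmPath n).IsStrong ∧ (Digraph.dirCycle m).IsStrong ∧
      ((Digraph.symmPath n).boxProd (Digraph.dirCycle m)).pendantTreeConnectivity 3 =
        (Digraph.symmPath n).pendantTreeConnectivity 3 +
          (Digraph.dirCycle m).pendantTreeConnectivity 3 ∧
      ((Digraph.symmPath n).boxProd (Digraph.dirCycle m)).pendantTreeConnectivity 3 = 0) := by
  refine ⟨fun D H _ _ hD hH => Digraph.add_le_pendantTreeConnectivity_boxProd hD hH,
    fun n m hn hm => ⟨Digraph.loopless_symmPath n, Digraph.loopless_dirCycle (by omega),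
      Digraph.isStrong_symmPath n, Digraph.isStrong_dirCycle m, ?_,
      Digraph.pendantTreeConnectivity_symmPath_boxProd_dirCycle hn hm⟩⟩
  rw [Digraph.pendantTreeConnectivity_symmPath_boxProd_dirCycle hn hm,
    Digraph.pendantTreeConnectivity_symmPath hn, Digraph.pendantTreeConnectivity_dirCycle hm]
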